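/- Let $R, L \ge 0$ be real numbers and let $\varphi = (\varphi(1), \varphi(2), \ldots)$, $\varphi(i) = (\varphi_i^{(x)}, \varphi_i^{(y)}) \in \{0,1\} \times \{0,1\}$, be a stochastic process. Fix $r \in \mathbb{R}$, $t > 0$ and $x \in \mathbb{Z}$. For $\varepsilon > 0$ put $\delta_1 = \varepsilon L$, $\delta_2 = \varepsilon R$, where $\varepsilon$ is so small that $\delta_1, \delta_2 \in [0, 1)$. *Stochastic six-vertex model* $\mathcal{P}(\delta_1, \delta_2)$ *with initial data* $\varphi$. This is a random ensemble of up-right directed paths in $\mathbb{Z}_{>0}^2$, in which paths may share vertices but not edges. A path, colored red, enters vertically through $(i, 1)$ if and only if $\varphi_i^{(x)} = 1$, and a path, colored blue, enters horizontally through $(1, i)$ if and only if $\varphi_i^{(y)} = 1$. Given $\varphi$, the vertices are completed successively along the diagonals $\{x + y = n\}$, independently of each other: a path that enters a vertex alone vertically leaves it vertically with probability $\delta_1$ and horizontally with probability $1 - \delta_1$; a path that enters a vertex alone horizontally leaves it horizontally with probability $\delta_2$ and vertically with probability $1 - \delta_2$; if two paths enter, then both edges leaving the vertex are used, and the paths touch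 without crossing. The height function $\mathfrak{H}(X, Y)$ is the number of blue paths that cross the line $y = Y$ to the right of $(X, Y)$ minus the number of red paths that cross it at or to the left of $(X, Y)$; here a path crosses the line $y = Y$ at the vertex from which it leaves this line upwards. *ASEP with initial data* $\varphi$. Particles move on $\mathbb{Z}$, at most one per site. Site $i > 0$ is initially occupied if and only if $\varphi_i^{(x)} = 1$, and site $i \le 0$ is initially occupied if and only if $\varphi_{1-i}^{(y)} = 1$. Independently of $\varphi$, there are independent Poisson clocks at all sites, a left clock of rate $L$ and a right clock of rate $R$ at each site; when a clock rings, a particle at that site attempts to jump one step in the corresponding direction, and jumps if and only if the destination is empty. (The process on $\mathbb{Z}$ is given by Harris' graphical construction.) If $X_k(t)$ denotes the position at time $t$ of particle $k$, the current is $$J_t(x) = \sum_k \big( \mathbf{1}_{X_k(0) \le 0} \mathbf{1}_{X_k(t) > x} - \mathbf{1}_{X_k(0) > 0} \mathbf{1}_{X_k(t) \le x} \big),$$ an almost surely finite sum over all particles. Then $$\lim_{\varepsilon \to 0^+} \mathbb{P} \big[ \mathfrak{H}(x + \lfloor \varepsilon^{-1} t \rfloor, \lfloor \varepsilon^{-1}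 t \rfloor) \ge r \big] = \mathbb{P} \big[ J_t(x) \ge r \big],$$ where the left probability is under the stochastic six-vertex model $\mathcal{P}(\delta_1, \delta_2)$ with initial data $\varphi$ and the right one under the ASEP with left jump rate $L$, right jump rate $R$ and initial data $\varphi$. -/

import Mathlib

open MeasureTheory ProbabilityTheory Filter Topology

namespace VertexASEP

/-! ## Initial data

The process `φ` is indexed by `1, 2, 3, …` (the value at index `0` is never used);
`(φ i).1` is the `x`-component and `(φ i).2` is the `y`-component of its value at `i`. -/

/-! ## The stochastic six-vertex model -/

/-- Red paths emanate from the `x`-axis, blue paths emanate from the `y`-axis. -/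
inductive PathColor
  | red
  | blue

/-- An edge is either empty or used by exactly one path, whose colour is recorded. -/
abbrev Edge := Option PathColor

/-- Completion of the half-configuration `(below, left)` of entering edges at a vertex into the
pair `(above, right)` of exiting edges. A path entering alone from below goes straight up with
probability `δ₁` and turns right with probability `1 - δ₁`; a path entering alone from the left
goes straight right with probability `δ₂` and turns up with probability `1 - δ₂`. The numbers
`u.1` and `u.2` are uniform on `[0, 1]` and perform these two random selections. Two paths that
meet at a vertex touch there without crossing: the one from below exits to the right and the one
from the left exits upwards. -/
noncomputable def completion (δ₁ δ₂ : ℝ) (u : unitInterval × unitInterval) :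
    Edge → Edge → Edge × Edge
  | none, none => (none, none)
  | some c, none => if (u.1 : ℝ) < δ₁ then (some c, none) else (none, some c)
  | none, some c => if (u.2 : ℝ) < δ₂ then (none, some c) else (some c, none)
  | some c, some d => (some d, some c)

/-- One row: the edge leaving the vertex in column `p ≥ 1` to the right, when `below` are the
edges entering the row from below, `left` is the edge entering column `1` from the left, and `u`
are the selections at the vertices of the row. Column `0` stands for the `y`-axis. -/
noncomputable def rowRight (δ₁ δ₂ : ℝ) (below : ℕ → Edge) (left : Edge)
    (u : ℕ → unitInterval × unitInterval) : ℕ → Edge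
  | 0 => left
  | p + 1 =>
      (completion δ₁ δ₂ (u (p + 1)) (below (p + 1)) (rowRight δ₁ δ₂ below left u p)).2

/-- The path ensemble determined by the initial data `φ` and the selections `u`:
`vertical δ₁ δ₂ φ u y p` is the edge from `(p, y)` to `(p, y + 1)`, for `p ≥ 1`. The site `(p, 1)`
is an entrance site for a (red) path iff `(φ p).1`, and the site `(1, y)` is an entrance site for
a (blue) path iff `(φ y).2`. -/
noncomputable def vertical (δ₁ δ₂ : ℝ) (φ : ℕ → Bool × Bool)
    (u : ℕ × ℕ → unitInterval × unitInterval) : ℕ → ℕ → Edge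
  | _, 0 => none
  | 0, p + 1 => if (φ (p + 1)).1 then some PathColor.red else none
  | y + 1, p + 1 =>
      (completion δ₁ δ₂ (u (p + 1, y + 1)) (vertical δ₁ δ₂ φ u y (p + 1))
        (rowRight δ₁ δ₂ (vertical δ₁ δ₂ φ u y)
          (if (φ (y + 1)).2 then some PathColor.blue else none)
          (fun q => u (q, y + 1)) p)).1

/-- The current (height function) at `(X, Y)`: the number of blue paths that cross the line
`y = Y` to the right of `(X, Y)`, minus the number of red paths that cross it at or to the left of
`(X, Y)`. The crossing place of a path is the vertex `(p, Y)` from which it leaves the line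
upwards. -/
noncomputable def height (δ₁ δ₂ : ℝ) (φ : ℕ → Bool × Bool)
    (u : ℕ × ℕ → unitInterval × unitInterval) (X : ℤ) (Y : ℕ) : ℤ :=
  ({p : ℕ | X < (p : ℤ) ∧ vertical δ₁ δ₂ φ u Y p = some PathColor.blue}.ncard : ℤ)
    - ({p : ℕ | (p : ℤ) ≤ X ∧ vertical δ₁ δ₂ φ u Y p = some PathColor.red}.ncard : ℤ)

/-- Law of the selections: independent over the vertices of the quadrant, each one a pair of
independent uniform variables on `[0, 1]`. -/
noncomputable def vertexMeasure : Measure (ℕ × ℕ → unitInterval × unitInterval) :=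
  Measure.infinitePi fun _ => (volume : Measure (unitInterval × unitInterval))

instance : IsProbabilityMeasure vertexMeasure := by
  unfold vertexMeasure; infer_instance

/-! ## The asymmetric simple exclusion process (Harris' graphical construction) -/

/-- The two clocks of a site. -/
inductive Direction
  | left
  | right

/-- For each site and each of its two clocks, the sequence of waiting times between
consecutive rings, measured in units of the mean waiting time. -/
abbrev Waiting := ℤ → Direction → ℕ → ℝ

/-- Ringing times of a clock of the given rate: the `n`-th ring occurs when `rate * t` is the sum
of the first `n` normalized waiting times. A clock of rate `0` never rings. -/
def rings (rate : ℝ) (w : ℕ → ℝ) : Set ℝ :=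
  {t | 0 < t ∧ ∃ n : ℕ, rate * t = ∑ m ∈ Finset.range (n + 1), w m}

/-- A jump instruction `(t; i, j)`: at time `t`, jump from site `i` to site `j`. Instructions
are ordered lexicographically, hence in the first place by time. -/
abbrev Instruction := ℝ ×ₗ (ℤ ×ₗ ℤ)

/-- The instruction `(t; i, j)`. -/
def instruction (t : ℝ) (i j : ℤ) : Instruction := toLex (t, toLex (i, j))

/-- The time of an instruction. -/
def Instruction.time (e : Instruction) : ℝ := (ofLex e).1

/-- The starting site of an instruction. -/
def Instruction.source (e : Instruction) : ℤ := (ofLex (ofLex e).2).1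

/-- The destination of an instruction. -/
def Instruction.target (e : Instruction) : ℤ := (ofLex (ofLex e).2).2

/-- The time graph with left rate `L` and right rate `R`. -/
def timeGraph (L R : ℝ) (w : Waiting) : Set Instruction :=
  {e | ∃ (t : ℝ) (i : ℤ),
      (t ∈ rings R (w i Direction.right) ∧ e = instruction t i (i + 1)) ∨
      (t ∈ rings L (w i Direction.left) ∧ e = instruction t i (i - 1))}

open scoped Classical in
/-- Execution of one instruction. The particles are tagged by their starting sites, which form the
set `A`; the particle tagged `s ∈ A` is at `pos s`. If a particle is at the source and the target
is unoccupied, it jumps there; otherwise nothing happens. -/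
noncomputable def execute (A : Set ℤ) (pos : ℤ → ℤ) (e : Instruction) : ℤ → ℤ :=
  fun s => if pos s = e.source ∧ ∀ s' ∈ A, pos s' ≠ e.target then e.target else pos s

open scoped Classical in
/-- Positions at time `t` of the tagged particles of the exclusion process in which only the
(almost surely finitely many) instructions with source in `[-N, N]` are executed, in the order of
their times. -/
noncomputable def boundedPosition (G : Set Instruction) (A : Set ℤ) (N : ℕ) (t : ℝ) : ℤ → ℤ :=
  if h : {e ∈ G | e.time ≤ t ∧ |e.source| ≤ (N : ℤ)}.Finite then
    (h.toFinset.sort (· ≤ ·)).foldl (execute A) id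
  else id

/-- Position at time `t` of the particle of the ASEP that starts at `s ∈ A`. Almost surely the
positions in the bounded processes are eventually constant in `N`, because there are inactive
sites arbitrarily far to the left and to the right; the position is this eventual value. -/
noncomputable def position (G : Set Instruction) (A : Set ℤ) (t : ℝ) (s : ℤ) : ℤ :=
  limUnder atTop fun N : ℕ => boundedPosition G A N t s

/-- Initially occupied sites of the ASEP with initial data `φ`: a site `i > 0` is occupied iff
`(φ i).1`, and a site `i ≤ 0` is occupied iff `(φ (1 - i)).2`. -/
def occupied (φ : ℕ → Bool × Bool) : Set ℤ :=
  {i | (0 < i ∧ (φ i.toNat).1 = true) ∨ (i ≤ 0 ∧ (φ (1 - i).toNat).2 = true)}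

open scoped Classical in
/-- The current `J_t(x)` of the ASEP with left jump rate `L`, right jump rate `R` and initial data
`φ`: an almost surely finite sum over all particles, here indexed by their starting sites `s`. -/
noncomputable def current (L R : ℝ) (φ : ℕ → Bool × Bool) (w : Waiting) (t : ℝ) (x : ℤ) : ℤ :=
  ∑ᶠ s ∈ occupied φ,
    ((if s ≤ 0 then 1 else 0) *
        (if x < position (timeGraph L R w) (occupied φ) t s then 1 else 0)
      - (if 0 < s then 1 else 0) *
        (if position (timeGraph L R w) (occupied φ) t s ≤ x then 1 else 0))

/-- Law of the normalized waiting times: all independent and exponential of rate `1`, so that the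
clocks ring according to independent Poisson processes. -/
noncomputable def waitingMeasure : Measure Waiting :=
  Measure.infinitePi fun _ : ℤ => Measure.infinitePi fun _ : Direction =>
    Measure.infinitePi fun _ : ℕ => expMeasure 1

instance : IsProbabilityMeasure waitingMeasure := by
  have : IsProbabilityMeasure (expMeasure 1) := isProbabilityMeasure_expMeasure one_pos
  unfold waitingMeasure; infer_instance

/-! ## The two probabilities

The initial data is a stochastic process on `(Ω, P)`, independent of the selections of the
six-vertex model and of the clocks of the ASEP. -/

/-- The probability that the height function at `(X, Y)` of the stochastic six-vertex model
with parameters `δ₁`, `δ₂` and initial data `φ` is at least `r`. -/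
noncomputable def heightProb {Ω : Type*} [MeasurableSpace Ω] (P : Measure Ω)
    (φ : ℕ → Ω → Bool × Bool) (δ₁ δ₂ : ℝ) (X : ℤ) (Y : ℕ) (r : ℝ) : ℝ :=
  (P.prod vertexMeasure).real {ω | r ≤ (height δ₁ δ₂ (fun i => φ i ω.1) ω.2 X Y : ℝ)}

/-- The probability that the current `J_t(x)` of the ASEP with left jump rate `L`, right jump
rate `R` and initial data `φ` is at least `r`. -/
noncomputable def currentProb {Ω : Type*} [MeasurableSpace Ω] (P : Measure Ω)
    (φ : ℕ → Ω → Bool × Bool) (L R : ℝ) (t : ℝ) (x : ℤ) (r : ℝ) : ℝ :=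
  (P.prod waitingMeasure).real {ω | r ≤ (current L R (fun i => φ i ω.1) ω.2 t x : ℝ)}

end VertexASEP

/-!
The convergence is proved by coupling all six-vertex models with one sample of the clocks of the
exclusion process.

**The moving frame.** Look at the path ensemble above row `y` with the column `p` put at the site
`p - y` (`frame`). A vertex at which both selections are the likely ones just sends the left edge up
and the edge from below to the right, and then the row does not move anything in the frame. Hence
row `y + 1` is a sweep over the frame edges `(i, i + 1)` from left to right (`frame_carry`), in which
an unlikely selection is an attempted jump across its edge: to the left from `i + 1` for the first
component, to the right from `i` for the second one. Colours travel with the particles, and the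
paths that wait to enter through the `y`-axis are the particles on the sites `i ≤ 0`. So the
six-vertex model is an exclusion process in discrete time, and the height function is its current.

**The coupling.** An exponential variable that is rounded up in units of `-log (1 - p)` is geometric
of parameter `p`. If the waiting times of a clock of rate `c` are rounded in this way with
`p = ε * c`, then the rows in which the rounded clock rings form a Bernoulli sequence of parameter `p`
(`map_bit`). Thus, for every `ε`, the rounded clocks have the law of the unlikely selections
(`map_coupledBits`, `heightProb_eq`). On the other hand, `ε` times the row of the `n`-th ring
converges to the time of the `n`-th ring for every sample (`tendsto_mul_discreteArrival`).

**Locality.** Almost surely there are edges without rings up to time `t` arbitrarily far to the left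
and to the right (`ae_frequently_inactive`). Between two such edges, the exclusion process executes a
finite list of instructions (`Harris.position_eq`). For small `ε`, the rounded clocks ring there in
distinct rows and in the same order, and so the six-vertex model executes the same list
(`frame_eqOn_foldl`). Therefore height and current are equal for all small `ε`
(`Regular.eventually_bitHeight_eq`), and dominated convergence yields the theorem.
-/

/-! ### Exclusion dynamics on configurations of colours -/

namespace VertexASEP

@[simp] lemma source_instruction (t : ℝ) (i j : ℤ) : (instruction t i j).source = i := rfl

@[simp] lemma target_instruction (t : ℝ) (i j : ℤ) : (instruction t i j).target = j := rfl

lemma Instruction.eta (e : Instruction) : instruction e.time e.source e.target = e := rfl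

open scoped Classical in
/-- Execution of an instruction on a configuration of coloured particles, described by the
colours (or `none`) of all sites: if the target is empty, the contents of source and target are
interchanged. -/
noncomputable def exchange (η : ℤ → Edge) (e : Instruction) : ℤ → Edge :=
  if η e.target = none then η ∘ Equiv.swap e.source e.target else η

open scoped Classical in
/-- The coloured configuration of tagged particles: the particle tagged `s ∈ A` is red if `0 < s`
and blue otherwise. -/
noncomputable def colour (A : Set ℤ) (pos : ℤ → ℤ) (i : ℤ) : Edge :=
  if ∃ s ∈ A, 0 < s ∧ pos s = i then some PathColor.red
  else if ∃ s ∈ A, s ≤ 0 ∧ pos s = i then some PathColor.blue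
  else none

lemma colour_eq_none {A : Set ℤ} {pos : ℤ → ℤ} {i : ℤ} :
    colour A pos i = none ↔ ∀ s ∈ A, pos s ≠ i := by
  unfold colour
  split_ifs with h1 h2
  · obtain ⟨s, hs, -, h⟩ := h1
    simpa using ⟨s, hs, h⟩
  · obtain ⟨s, hs, -, h⟩ := h2
    simpa using ⟨s, hs, h⟩
  · push Not at h1 h2
    simp only [true_iff]
    intro s hs
    rcases lt_or_ge 0 s with h | h
    · exact h1 s hs h
    · exact h2 s hs h

lemma colour_eq_red {A : Set ℤ} {pos : ℤ → ℤ} {i : ℤ} :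
    colour A pos i = some PathColor.red ↔ ∃ s ∈ A, 0 < s ∧ pos s = i := by
  unfold colour
  split_ifs with h1 h2 <;> simp [h1]

lemma colour_eq_blue {A : Set ℤ} {pos : ℤ → ℤ} (hpos : Set.InjOn pos A) {i : ℤ} :
    colour A pos i = some PathColor.blue ↔ ∃ s ∈ A, s ≤ 0 ∧ pos s = i := by
  unfold colour
  split_ifs with h1 h2
  · simp only [Option.some.injEq, reduceCtorEq, false_iff, not_exists, not_and]
    obtain ⟨s, hs, h, hi⟩ := h1
    intro s' hs' h' hi'
    have := hpos hs hs' (hi.trans hi'.symm)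
    omega
  · simp [h2]
  · simp [h2]

lemma execute_of_occupied {A : Set ℤ} {pos : ℤ → ℤ} {e : Instruction}
    (h : ∃ s ∈ A, pos s = e.target) : execute A pos e = pos := by
  obtain ⟨s, hs, h⟩ := h
  funext s'
  unfold execute
  rw [if_neg]
  rintro ⟨-, h'⟩
  exact h' s hs h

lemma execute_of_vacant {A : Set ℤ} {pos : ℤ → ℤ} {e : Instruction}
    (h : ∀ s ∈ A, pos s ≠ e.target) {s : ℤ} (hs : s ∈ A) :
    execute A pos e s = Equiv.swap e.source e.target (pos s) := by
  unfold execute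
  split_ifs with h1
  · rw [h1.1, Equiv.swap_apply_left]
  · rw [Equiv.swap_apply_of_ne_of_ne (fun h2 => h1 ⟨h2, h⟩) (h s hs)]

lemma injOn_execute {A : Set ℤ} {pos : ℤ → ℤ} (hpos : Set.InjOn pos A) (e : Instruction) :
    Set.InjOn (execute A pos e) A := by
  by_cases h : ∃ s ∈ A, pos s = e.target
  · rwa [execute_of_occupied h]
  · push Not at h
    intro s hs s' hs' hss
    rw [execute_of_vacant h hs, execute_of_vacant h hs'] at hss
    exact hpos hs hs' ((Equiv.swap _ _).injective hss)

lemma colour_execute (A : Set ℤ) (pos : ℤ → ℤ) (e : Instruction) :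
    colour A (execute A pos e) = exchange (colour A pos) e := by
  unfold exchange
  by_cases h : ∃ s ∈ A, pos s = e.target
  · rw [execute_of_occupied h, if_neg]
    rw [colour_eq_none]
    simpa using h
  · push Not at h
    rw [if_pos (colour_eq_none.2 h)]
    funext i
    have key : ∀ s ∈ A, (execute A pos e s = i ↔ pos s = Equiv.swap e.source e.target i) := by
      intro s hs
      rw [execute_of_vacant h hs, ← Equiv.eq_symm_apply, Equiv.symm_swap]
    have h1 : (∃ s ∈ A, 0 < s ∧ execute A pos e s = i) ↔
        ∃ s ∈ A, 0 < s ∧ pos s = Equiv.swap e.source e.target i :=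
      exists_congr fun s => and_congr_right fun hs => and_congr_right fun _ => key s hs
    have h2 : (∃ s ∈ A, s ≤ 0 ∧ execute A pos e s = i) ↔
        ∃ s ∈ A, s ≤ 0 ∧ pos s = Equiv.swap e.source e.target i :=
      exists_congr fun s => and_congr_right fun hs => and_congr_right fun _ => key s hs
    classical exact if_congr h1 rfl (if_congr h2 rfl rfl)

lemma injOn_foldl_execute {A : Set ℤ} (l : List Instruction) {pos : ℤ → ℤ}
    (hpos : Set.InjOn pos A) : Set.InjOn (l.foldl (execute A) pos) A := by
  induction l generalizing pos with
  | nil => exact hpos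
  | cons e l ih => exact ih (injOn_execute hpos e)

lemma colour_foldl_execute (A : Set ℤ) (l : List Instruction) (pos : ℤ → ℤ) :
    colour A (l.foldl (execute A) pos) = l.foldl exchange (colour A pos) := by
  induction l generalizing pos with
  | nil => rfl
  | cons e l ih => rw [List.foldl_cons, List.foldl_cons, ih, colour_execute]

lemma exchange_congr {I : Set ℤ} {η η' : ℤ → Edge} (h : Set.EqOn η η' I) {e : Instruction}
    (hs : e.source ∈ I) (ht : e.target ∈ I) : Set.EqOn (exchange η e) (exchange η' e) I := by
  intro i hi
  have key : η (Equiv.swap e.source e.target i) = η' (Equiv.swap e.source e.target i) := by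
    apply h
    rcases eq_or_ne i e.source with rfl | h1
    · rwa [Equiv.swap_apply_left]
    rcases eq_or_ne i e.target with rfl | h2
    · rwa [Equiv.swap_apply_right]
    rwa [Equiv.swap_apply_of_ne_of_ne h1 h2]
  unfold exchange
  rw [h ht]
  split_ifs
  · exact key
  · exact h hi

/-! ### Tagged particles in a box that no instruction leaves or enters -/

/-- Instructions outside of `I` are invisible for the particles in `I`, so both the evolution of
these particles and the fact that they stay in `I` only depend on the instructions inside. -/
lemma foldl_execute_filter {A I : Set ℤ} [DecidablePred fun e : Instruction => e.source ∈ I]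
    {l : List Instruction} (hl : ∀ e ∈ l, (e.source ∈ I ↔ e.target ∈ I)) {pos pos' : ℤ → ℤ}
    (hpos : ∀ s, pos s ∈ I ↔ s ∈ I) (hpos' : ∀ s, pos' s ∈ I ↔ s ∈ I)
    (heq : Set.EqOn pos pos' I) :
    (∀ s, l.foldl (execute A) pos s ∈ I ↔ s ∈ I) ∧
      Set.EqOn (l.foldl (execute A) pos)
        ((l.filter fun e => e.source ∈ I).foldl (execute A) pos') I := by
  have step : ∀ (e : Instruction) (p : ℤ → ℤ), (e.source ∈ I ↔ e.target ∈ I) →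
      (∀ s, p s ∈ I ↔ s ∈ I) → ∀ s, execute A p e s ∈ I ↔ s ∈ I := by
    intro e p he hp s
    unfold execute
    split_ifs with h
    · rw [← he, ← h.1, hp]
    · exact hp s
  induction l generalizing pos pos' with
  | nil => exact ⟨hpos, heq⟩
  | cons e l ih =>
    have he := hl e (by simp)
    have hl' : ∀ e ∈ l, (e.source ∈ I ↔ e.target ∈ I) := fun e h => hl e (by simp [h])
    rw [List.foldl_cons]
    by_cases h : e.source ∈ I
    · rw [List.filter_cons_of_pos (by simpa using h), List.foldl_cons]
      refine ih hl' (step e pos he hpos) (step e pos' he hpos') ?_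
      intro s hs
      have hocc : (∀ s' ∈ A, pos s' ≠ e.target) ↔ ∀ s' ∈ A, pos' s' ≠ e.target := by
        refine forall₂_congr fun s' _ => not_congr ?_
        by_cases hs' : s' ∈ I
        · rw [heq hs']
        · have h1 := mt (hpos s').1 hs'
          have h2 := mt (hpos' s').1 hs'
          constructor <;> intro h3
          · exact absurd (h3 ▸ he.1 h) h1
          · exact absurd (h3 ▸ he.1 h) h2
      classical exact if_congr (and_congr (by rw [heq hs]) hocc) rfl (heq hs)
    · rw [List.filter_cons_of_neg (by simpa using h)]
      refine ih hl' (step e pos he hpos) hpos' ?_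
      intro s hs
      rw [← heq hs, execute, if_neg]
      rintro ⟨h1, -⟩
      exact h (h1 ▸ (hpos s).2 hs)

lemma foldl_execute_mem_iff {A I : Set ℤ} {l : List Instruction}
    (hl : ∀ e ∈ l, (e.source ∈ I ↔ e.target ∈ I)) (s : ℤ) :
    l.foldl (execute A) id s ∈ I ↔ s ∈ I := by
  classical
  exact (foldl_execute_filter hl (fun _ => Iff.rfl) (fun _ => Iff.rfl) fun _ _ => rfl).1 s

lemma filter_sort_eq {α : Type*} [LinearOrder α] (S : Finset α) (p : α → Prop)
    [DecidablePred p] :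
    (S.sort (· ≤ ·)).filter (fun a => p a) = (S.filter p).sort (· ≤ ·) := by
  refine List.Perm.eq_of_pairwise (le := (· ≤ ·)) (fun a b _ _ => le_antisymm) ?_ ?_ ?_
  · exact (Finset.pairwise_sort _ _).filter _
  · exact Finset.pairwise_sort _ _
  · rw [List.perm_ext_iff_of_nodup ((Finset.sort_nodup _ _).filter _) (Finset.sort_nodup _ _)]
    simp

end VertexASEP

/-! ### The six-vertex model in the moving frame -/

namespace VertexASEP

section SixVertex

variable {δ₁ δ₂ : ℝ} {φ : ℕ → Bool × Bool} {u : ℕ × ℕ → unitInterval × unitInterval}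

variable (δ₁ δ₂ φ u) in
/-- The six-vertex configuration above row `y` in the moving frame, in which the vertical edge in
column `p` above row `y` is found at the site `p - y`. The sites whose columns are not positive
wait for the paths that enter through the `y`-axis in later rows. -/
noncomputable def frame (y : ℕ) (i : ℤ) : Edge :=
  if 0 < i + y then vertical δ₁ δ₂ φ u y (i + y).toNat
  else if (φ (1 - i).toNat).2 then some PathColor.blue else none

variable (δ₁ δ₂ φ u) in
/-- The horizontal edge of row `y + 1` that leaves column `i + y`. It is about to enter the vertex
of the frame edge `(i, i + 1)`. -/
noncomputable def carry (y : ℕ) (i : ℤ) : Edge :=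
  rowRight δ₁ δ₂ (vertical δ₁ δ₂ φ u y) (if (φ (y + 1)).2 then some PathColor.blue else none)
    (fun q => u (q, y + 1)) (i + y).toNat

/-- The selections at the vertex of row `y + 1` that belongs to the frame edge `(i, i + 1)`. -/
def selection (u : ℕ × ℕ → unitInterval × unitInterval) (y : ℕ) (i : ℤ) :
    unitInterval × unitInterval :=
  u ((i + y + 1).toNat, y + 1)

variable (δ₁ δ₂ u) in
/-- A vertex is silent if both of its selections are the likely ones; then the left edge exits
above and the edge from below exits to the right. -/
def Silent (y : ℕ) (i : ℤ) : Prop :=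
  δ₁ ≤ (selection u y i).1 ∧ δ₂ ≤ (selection u y i).2

lemma completion_of_le {v : unitInterval × unitInterval} (h₁ : δ₁ ≤ v.1) (h₂ : δ₂ ≤ v.2)
    (e f : Edge) : completion δ₁ δ₂ v e f = (f, e) := by
  rcases e with _ | c <;> rcases f with _ | d <;> simp [completion, not_lt.2 h₁, not_lt.2 h₂]

lemma completion_left {v : unitInterval × unitInterval} (h₁ : v.1 < δ₁) (h₂ : δ₂ ≤ v.2)
    (e f : Edge) : completion δ₁ δ₂ v e f = if f = none then (e, f) else (f, e) := by
  rcases e with _ | c <;> rcases f with _ | d <;> simp [completion, h₁, not_lt.2 h₂]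

lemma completion_right {v : unitInterval × unitInterval} (h₁ : δ₁ ≤ v.1) (h₂ : v.2 < δ₂)
    (e f : Edge) : completion δ₁ δ₂ v e f = if e = none then (e, f) else (f, e) := by
  rcases e with _ | c <;> rcases f with _ | d <;> simp [completion, h₂, not_lt.2 h₁]

lemma completion_ne {v : unitInterval × unitInterval} {e f : Edge} {c : PathColor}
    (he : e ≠ some c) (hf : f ≠ some c) :
    (completion δ₁ δ₂ v e f).1 ≠ some c ∧ (completion δ₁ δ₂ v e f).2 ≠ some c := by
  rcases e with _ | e <;> rcases f with _ | f <;> simp only [completion] <;> (try split_ifs) <;>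
    simp_all

lemma frame_zero : frame δ₁ δ₂ φ u 0 = colour (occupied φ) id := by
  funext i
  rcases lt_or_ge 0 i with hi | hi
  · obtain ⟨p, hp⟩ : ∃ p : ℕ, i.toNat = p + 1 := ⟨i.toNat - 1, by omega⟩
    have h1 : (∃ s ∈ occupied φ, 0 < s ∧ id s = i) ↔ (φ (p + 1)).1 = true := by
      simp [occupied, hi, hp, not_le.2 hi]
    have h2 : ¬ ∃ s ∈ occupied φ, s ≤ 0 ∧ id s = i := by
      rintro ⟨s, -, h, rfl⟩
      simp only [id] at hi
      omega
    simp [frame, colour, hi, hp, vertical, -id_eq, h1, h2]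
  · have h1 : ¬ ∃ s ∈ occupied φ, 0 < s ∧ id s = i := by
      rintro ⟨s, -, h, rfl⟩
      simp only [id] at hi
      omega
    have h2 : (∃ s ∈ occupied φ, s ≤ 0 ∧ id s = i) ↔ (φ (1 - i).toNat).2 = true := by
      simp [occupied, hi, not_lt.2 hi]
    simp [frame, colour, not_lt.2 hi, -id_eq, h1, h2]

lemma frame_succ_of_lt {y : ℕ} {i : ℤ} (hi : i + y < 0) :
    frame δ₁ δ₂ φ u (y + 1) i = frame δ₁ δ₂ φ u y i := by
  unfold frame
  rw [if_neg (show ¬ 0 < i + ((y + 1 : ℕ) : ℤ) by push_cast; omega),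
    if_neg (show ¬ 0 < i + (y : ℤ) by omega)]

lemma carry_start (y : ℕ) : carry δ₁ δ₂ φ u y (-y) = frame δ₁ δ₂ φ u y (-y) := by
  rw [frame, if_neg (by omega), carry]
  have h1 : (-(y : ℤ) + y).toNat = 0 := by omega
  have h2 : (1 - -(y : ℤ)).toNat = y + 1 := by omega
  rw [h1, h2, rowRight]

/-- In the moving frame, row `y + 1` is a sweep over the edges `(i, i + 1)` from left to right. -/
lemma frame_carry {y : ℕ} {i : ℤ} (hi : 0 ≤ i + y) :
    (frame δ₁ δ₂ φ u (y + 1) i, carry δ₁ δ₂ φ u y (i + 1)) =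
      completion δ₁ δ₂ (selection u y i) (frame δ₁ δ₂ φ u y (i + 1)) (carry δ₁ δ₂ φ u y i) := by
  obtain ⟨p, hp⟩ : ∃ p : ℕ, i + y = p := ⟨(i + y).toNat, by omega⟩
  have h1 : (i + ((y + 1 : ℕ) : ℤ)).toNat = p + 1 := by push_cast; omega
  have h2 : (i + 1 + (y : ℤ)).toNat = p + 1 := by omega
  have h3 : (i + (y : ℤ) + 1).toNat = p + 1 := by omega
  have h4 : (i + (y : ℤ)).toNat = p := by omega
  rw [frame, if_pos (by push_cast; omega), frame, if_pos (by omega), carry, carry, selection,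
    h1, h2, h3, h4, vertical, rowRight]

lemma frame_carry_of_silent {y : ℕ} {i : ℤ} (hi : 0 ≤ i + y) (hs : Silent δ₁ δ₂ u y i) :
    frame δ₁ δ₂ φ u (y + 1) i = carry δ₁ δ₂ φ u y i ∧
      carry δ₁ δ₂ φ u y (i + 1) = frame δ₁ δ₂ φ u y (i + 1) := by
  have h := frame_carry (δ₁ := δ₁) (δ₂ := δ₂) (φ := φ) (u := u) hi
  rw [completion_of_le hs.1 hs.2] at h
  exact Prod.mk.inj h

lemma carry_eq_frame {y : ℕ} {m : ℤ} (hm : 0 ≤ m + y)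
    (h : carry δ₁ δ₂ φ u y m = frame δ₁ δ₂ φ u y m) {i : ℤ} (hmi : m ≤ i)
    (hs : ∀ j, m ≤ j → j < i → Silent δ₁ δ₂ u y j) :
    carry δ₁ δ₂ φ u y i = frame δ₁ δ₂ φ u y i := by
  induction i, hmi using Int.leInduction with
  | base => exact h
  | succ i hi ih => exact (frame_carry_of_silent (by omega) (hs i hi (by omega))).2

lemma frame_succ_of_silent {y : ℕ} {m : ℤ} (hm : 0 ≤ m + y)
    (h : carry δ₁ δ₂ φ u y m = frame δ₁ δ₂ φ u y m) {i : ℤ} (hmi : m ≤ i)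
    (hs : ∀ j, m ≤ j → j ≤ i → Silent δ₁ δ₂ u y j) :
    frame δ₁ δ₂ φ u (y + 1) i = frame δ₁ δ₂ φ u y i :=
  (frame_carry_of_silent (by omega) (hs i hmi le_rfl)).1.trans
    (carry_eq_frame hm h hmi fun j h1 h2 => hs j h1 h2.le)

/-- A row without unlikely selections between two silent edges `(a, a + 1)` and `(b, b + 1)`
does not change the frame between them. -/
lemma frame_succ_eqOn {y : ℕ} {a b : ℤ} (hs : ∀ j, a ≤ j → j ≤ b → 0 ≤ j + y → Silent δ₁ δ₂ u y j) :
    Set.EqOn (frame δ₁ δ₂ φ u (y + 1)) (frame δ₁ δ₂ φ u y) (Set.Ioc a b) := by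
  rintro i ⟨hai, hib⟩
  rcases lt_or_ge (i + y) 0 with hi | hi
  · exact frame_succ_of_lt hi
  rcases lt_or_ge (a + y) 0 with ha | ha
  · exact frame_succ_of_silent (m := -y) (by omega) (carry_start y) (by omega)
      fun j h1 h2 => hs j (by omega) (by omega) (by omega)
  · exact frame_succ_of_silent (m := a + 1) (by omega)
      (frame_carry_of_silent ha (hs a le_rfl (by omega) ha)).2 (by omega)
      fun j h1 h2 => hs j (by omega) (by omega) (by omega)

/-- A row with exactly one unlikely selection between two silent edges executes the corresponding
instruction between these edges. -/
lemma frame_succ_exchange {y : ℕ} {a b j : ℤ} {e : Instruction} (ha : 0 ≤ a + y) (haj : a < j)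
    (hjb : j < b) (hs : ∀ i, a ≤ i → i ≤ b → i ≠ j → Silent δ₁ δ₂ u y i)
    (he : (e.source = j ∧ e.target = j + 1 ∧ δ₁ ≤ (selection u y j).1 ∧
        (selection u y j).2 < δ₂) ∨
      (e.source = j + 1 ∧ e.target = j ∧ (selection u y j).1 < δ₁ ∧
        δ₂ ≤ (selection u y j).2)) :
    Set.EqOn (frame δ₁ δ₂ φ u (y + 1)) (exchange (frame δ₁ δ₂ φ u y) e) (Set.Ioc a b) := by
  set η := frame δ₁ δ₂ φ u y with hη
  have h0 : carry δ₁ δ₂ φ u y (a + 1) = η (a + 1) :=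
    (frame_carry_of_silent ha (hs a le_rfl (by omega) (by omega))).2
  have hj : carry δ₁ δ₂ φ u y j = η j :=
    carry_eq_frame (by omega) h0 (by omega) fun i h1 h2 => hs i (by omega) (by omega) (by omega)
  have hc := frame_carry (δ₁ := δ₁) (δ₂ := δ₂) (φ := φ) (u := u) (y := y) (i := j) (by omega)
  rw [hj, ← hη] at hc
  have hj1 : frame δ₁ δ₂ φ u (y + 1) (j + 1) = carry δ₁ δ₂ φ u y (j + 1) :=
    (frame_carry_of_silent (by omega) (hs (j + 1) (by omega) (by omega) (by omega))).1
  have hj2 : carry δ₁ δ₂ φ u y (j + 1 + 1) = η (j + 1 + 1) :=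
    (frame_carry_of_silent (by omega) (hs (j + 1) (by omega) (by omega) (by omega))).2
  -- After the vertex of the edge `(j, j + 1)` the sweep is as in a silent row again.
  have hout : ∀ i, a < i → i ≤ b → i ≠ j → i ≠ j + 1 → frame δ₁ δ₂ φ u (y + 1) i = η i := by
    intro i hai hib hij hij1
    rcases lt_or_gt_of_ne hij with h | h
    · exact frame_succ_of_silent (m := a + 1) (by omega) h0 (by omega)
        fun k h1 h2 => hs k (by omega) (by omega) (by omega)
    · exact frame_succ_of_silent (m := j + 1 + 1) (by omega) hj2 (by omega)
        fun k h1 h2 => hs k (by omega) (by omega) (by omega)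
  have hsel : (frame δ₁ δ₂ φ u (y + 1) j, carry δ₁ δ₂ φ u y (j + 1)) =
      (exchange η e j, exchange η e (j + 1)) := by
    rw [hc]
    rcases he with ⟨h1, h2, h3, h4⟩ | ⟨h1, h2, h3, h4⟩
    · rw [completion_right h3 h4]
      unfold exchange
      rw [h1, h2]
      split_ifs <;> simp
    · rw [completion_left h3 h4]
      unfold exchange
      rw [h1, h2]
      split_ifs <;> simp
  obtain ⟨hsel1, hsel2⟩ := Prod.mk.inj hsel
  rintro i ⟨hai, hib⟩
  by_cases hij : i = j
  · rw [hij, hsel1]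
  by_cases hij1 : i = j + 1
  · rw [hij1, hj1, hsel2]
  rw [hout i hai hib hij hij1]
  unfold exchange
  split_ifs
  · rw [Function.comp, Equiv.swap_apply_of_ne_of_ne] <;> rcases he with h | h <;> omega
  · rfl

lemma filter_le_succ_of_exists {α : Type*} {l : List α} {ρ : α → ℕ}
    (hl : l.Pairwise fun a b => ρ a < ρ b) {e : α} (he : e ∈ l) :
    (l.filter fun a => ρ a ≤ ρ e) = (l.filter fun a => ρ a < ρ e) ++ [e] := by
  induction l with
  | nil => simp at he
  | cons a l ih =>
    rw [List.pairwise_cons] at hl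
    rcases List.mem_cons.1 he with rfl | he
    · have h1 : l.filter (fun a => ρ a ≤ ρ e) = [] := by
        simpa using hl.1
      have h2 : l.filter (fun a => ρ a < ρ e) = [] := by
        simpa using fun a ha => (hl.1 a ha).le
      simp [h1, h2]
    · have h := hl.1 e he
      simp [h.le, h, ih hl.2 he]

/-- If the unlikely selections between two silent edges are given by a list of instructions of
which no two belong to the same row, then the frame between these edges results from the
execution of this list. -/
lemma frame_eqOn_foldl {a b : ℤ} (ha : a < 0) {Y : ℕ} {l : List Instruction} {ρ : Instruction → ℕ}
    (hl : l.Pairwise fun e e' => ρ e < ρ e')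
    (hbox : ∀ e ∈ l, e.source ∈ Set.Ioc a b ∧ e.target ∈ Set.Ioc a b)
    (hρ : ∀ e ∈ l, -a < ρ e)
    (hnn : ∀ e ∈ l, e.target = e.source + 1 ∨ e.source = e.target + 1)
    (hright : ∀ y < Y, ∀ j, a ≤ j → j ≤ b → 0 ≤ j + y → ((selection u y j).2 < δ₂ ↔
      ∃ e ∈ l, ρ e = y + 1 ∧ e.source = j ∧ e.target = j + 1))
    (hleft : ∀ y < Y, ∀ j, a ≤ j → j ≤ b → 0 ≤ j + y → ((selection u y j).1 < δ₁ ↔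
      ∃ e ∈ l, ρ e = y + 1 ∧ e.source = j + 1 ∧ e.target = j))
    {y : ℕ} (hy : y ≤ Y) :
    Set.EqOn (frame δ₁ δ₂ φ u y)
      ((l.filter fun e => ρ e ≤ y).foldl exchange (frame δ₁ δ₂ φ u 0)) (Set.Ioc a b) := by
  induction y with
  | zero =>
    have h : (l.filter fun e => ρ e ≤ 0) = [] := by
      rw [List.filter_eq_nil_iff]
      intro e he
      have := hρ e he
      simp only [decide_eq_true_eq]
      omega
    rw [h]
    exact fun _ _ => rfl
  | succ y ih =>
    have ih := ih (by omega)
    have hinj : ∀ e ∈ l, ∀ e' ∈ l, ρ e = ρ e' → e = e' := by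
      have h : (l.map ρ).Nodup := List.pairwise_map.2 (hl.imp ne_of_lt)
      exact fun e he e' he' h' => List.inj_on_of_nodup_map h he he' h'
    by_cases h : ∃ e ∈ l, ρ e = y + 1
    · obtain ⟨e, he, hey⟩ := h
      have hfilter : (l.filter fun a => ρ a ≤ y + 1) = (l.filter fun a => ρ a ≤ y) ++ [e] := by
        have := filter_le_succ_of_exists hl he
        rw [hey] at this
        simpa only [Nat.lt_succ_iff] using this
      rw [hfilter, List.foldl_append]
      have hae := hρ e he
      have hb := hbox e he
      have hse : ∀ e' ∈ l, ρ e' = y + 1 → e' = e :=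
        fun e' he' h => hinj e' he' e he (h.trans hey.symm)
      refine Set.EqOn.trans ?_ (exchange_congr ih hb.1 hb.2)
      have hs : ∀ i, a ≤ i → i ≤ b → i ≠ min e.source e.target → Silent δ₁ δ₂ u y i := by
        intro i h1 h2 h3
        refine ⟨not_lt.1 fun h => ?_, not_lt.1 fun h => ?_⟩
        · obtain ⟨e', he', h4, h5, h6⟩ := (hleft y (by omega) i h1 h2 (by omega)).1 h
          obtain rfl := hse e' he' h4
          omega
        · obtain ⟨e', he', h4, h5, h6⟩ := (hright y (by omega) i h1 h2 (by omega)).1 h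
          obtain rfl := hse e' he' h4
          omega
      have h1 := hb.1.1
      have h2 := hb.1.2
      have h3 := hb.2.1
      have h4 := hb.2.2
      rcases hnn e he with h | h
      · refine frame_succ_exchange (j := e.source) (by omega) h1 (by omega)
          (fun i h5 h6 h7 => hs i h5 h6 (by omega)) (Or.inl ⟨rfl, h, not_lt.1 fun h' => ?_, ?_⟩)
        · obtain ⟨e', he', h5, h6, h7⟩ := (hleft y (by omega) e.source h1.le h2 (by omega)).1 h'
          obtain rfl := hse e' he' h5
          omega
        · exact (hright y (by omega) e.source h1.le h2 (by omega)).2 ⟨e, he, hey, rfl, h⟩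
      · refine frame_succ_exchange (j := e.target) (by omega) h3 (by omega)
          (fun i h5 h6 h7 => hs i h5 h6 (by omega)) (Or.inr ⟨h, rfl, ?_, not_lt.1 fun h' => ?_⟩)
        · exact (hleft y (by omega) e.target h3.le h4 (by omega)).2 ⟨e, he, hey, h, rfl⟩
        · obtain ⟨e', he', h5, h6, h7⟩ := (hright y (by omega) e.target h3.le h4 (by omega)).1 h'
          obtain rfl := hse e' he' h5
          omega
    · push Not at h
      have hfilter : (l.filter fun a => ρ a ≤ y + 1) = l.filter fun a => ρ a ≤ y := by
        refine List.filter_congr fun e he => ?_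
        have := h e he
        simp only [decide_eq_decide]
        omega
      rw [hfilter]
      refine Set.EqOn.trans (frame_succ_eqOn ?_) ih
      intro j h1 h2 h3
      refine ⟨not_lt.1 fun h' => ?_, not_lt.1 fun h' => ?_⟩
      · obtain ⟨e', he', h5, -⟩ := (hleft y (by omega) j h1 h2 h3).1 h'
        exact h e' he' h5
      · obtain ⟨e', he', h5, -⟩ := (hright y (by omega) j h1 h2 h3).1 h'
        exact h e' he' h5

/-- No red path crosses a silent edge `(a, a + 1)` with `a < 0` from the right to the left. -/
lemma frame_ne_red {a : ℤ} (ha : a < 0) {Y : ℕ}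
    (hs : ∀ y < Y, 0 ≤ a + y → Silent δ₁ δ₂ u y a) {y : ℕ} (hy : y ≤ Y) :
    ∀ i ≤ a, frame δ₁ δ₂ φ u y i ≠ some PathColor.red := by
  induction y with
  | zero =>
    intro i hi
    rw [frame_zero, Ne, colour_eq_red]
    rintro ⟨s, -, h, rfl⟩
    simp only [id] at hi
    omega
  | succ y ih =>
    have ih := ih (by omega)
    intro i hi
    rcases lt_or_ge (i + y) 0 with h | h
    · rw [frame_succ_of_lt h]
      exact ih i hi
    have hcarry : ∀ k, -(y : ℤ) ≤ k → k ≤ a → carry δ₁ δ₂ φ u y k ≠ some PathColor.red := by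
      intro k hk
      induction k, hk using Int.leInduction with
      | base =>
        intro h1
        rw [carry_start]
        exact ih _ h1
      | succ k hk ihk =>
        intro h1
        have h2 := frame_carry (δ₁ := δ₁) (δ₂ := δ₂) (φ := φ) (u := u) (y := y) (i := k) (by omega)
        have h3 := (completion_ne (δ₁ := δ₁) (δ₂ := δ₂) (v := selection u y k) (ih (k + 1) h1)
          (ihk (by omega))).2
        rwa [← h2] at h3
    rcases hi.lt_or_eq with h1 | rfl
    · have h2 := frame_carry (δ₁ := δ₁) (δ₂ := δ₂) (φ := φ) (u := u) (y := y) (i := i) h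
      have h3 := (completion_ne (δ₁ := δ₁) (δ₂ := δ₂) (v := selection u y i) (ih (i + 1) h1)
        (hcarry i (by omega) hi)).1
      rwa [← h2] at h3
    · rw [(frame_carry_of_silent h (hs y (by omega) h)).1]
      exact hcarry i (by omega) le_rfl

/-- No blue path crosses a silent edge `(b, b + 1)` with `0 ≤ b` from the left to the right. -/
lemma frame_ne_blue {b : ℤ} (hb : 0 ≤ b) {Y : ℕ}
    (hs : ∀ y < Y, Silent δ₁ δ₂ u y b) {y : ℕ} (hy : y ≤ Y) :
    ∀ i > b, frame δ₁ δ₂ φ u y i ≠ some PathColor.blue := by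
  induction y with
  | zero =>
    intro i hi
    rw [frame_zero]
    unfold colour
    split_ifs with h1 h2
    · simp
    · obtain ⟨s, -, h, rfl⟩ := h2
      simp only [id] at hi
      omega
    · simp
  | succ y ih =>
    have ih := ih (by omega)
    have hcarry : ∀ k, b + 1 ≤ k → carry δ₁ δ₂ φ u y k ≠ some PathColor.blue := by
      intro k hk
      induction k, hk using Int.leInduction with
      | base =>
        rw [(frame_carry_of_silent (by omega) (hs y (by omega))).2]
        exact ih _ (by omega)
      | succ k hk ihk =>
        have h2 := frame_carry (δ₁ := δ₁) (δ₂ := δ₂) (φ := φ) (u := u) (y := y) (i := k) (by omega)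
        have h3 := (completion_ne (δ₁ := δ₁) (δ₂ := δ₂) (v := selection u y k)
          (ih (k + 1) (by omega)) ihk).2
        rwa [← h2] at h3
    intro i hi
    have h2 := frame_carry (δ₁ := δ₁) (δ₂ := δ₂) (φ := φ) (u := u) (y := y) (i := i) (by omega)
    have h3 := (completion_ne (δ₁ := δ₁) (δ₂ := δ₂) (v := selection u y i) (ih (i + 1) (by omega))
      (hcarry i (by omega))).1
    rwa [← h2] at h3

lemma frame_of_vertical {Y p : ℕ} {c : PathColor} (h : vertical δ₁ δ₂ φ u Y p = some c) :
    frame δ₁ δ₂ φ u Y (p - Y) = some c := by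
  have hp : 0 < p := by
    rcases Nat.eq_zero_or_pos p with rfl | h'
    · cases Y <;> simp [vertical] at h
    · exact h'
  rw [frame, if_pos (by omega), ← h]
  congr 1
  omega

lemma vertical_of_frame {Y : ℕ} {i : ℤ} {c : PathColor} (hi : 0 < i + Y)
    (h : frame δ₁ δ₂ φ u Y i = some c) : vertical δ₁ δ₂ φ u Y (i + Y).toNat = some c := by
  rwa [frame, if_pos hi] at h

/-- The height function in terms of the part of the frame between two silent edges. -/
lemma height_eq_ncard {a b x : ℤ} {Y : ℕ} (ha : a < 0) (hb : 0 ≤ b) (hY : 0 ≤ a + Y)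
    (hax : a ≤ x) (hxb : x ≤ b)
    (hsa : ∀ y < Y, 0 ≤ a + y → Silent δ₁ δ₂ u y a) (hsb : ∀ y < Y, Silent δ₁ δ₂ u y b) :
    height δ₁ δ₂ φ u (x + Y) Y =
      ({i ∈ Set.Ioc a b | x < i ∧ frame δ₁ δ₂ φ u Y i = some PathColor.blue}.ncard : ℤ) -
        ({i ∈ Set.Ioc a b | i ≤ x ∧ frame δ₁ δ₂ φ u Y i = some PathColor.red}.ncard : ℤ) := by
  unfold height
  congr 2
  · refine Set.ncard_congr (fun p _ => (p : ℤ) - Y) ?_ ?_ ?_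
    · rintro p ⟨h1, h2⟩
      have h3 := frame_of_vertical h2
      refine ⟨⟨by omega, ?_⟩, by omega, h3⟩
      by_contra h4
      exact frame_ne_blue hb hsb le_rfl _ (not_le.1 h4) h3
    · intro p p' _ _ h
      simpa using h
    · rintro i ⟨⟨h1, h2⟩, h3, h4⟩
      exact ⟨(i + Y).toNat, ⟨by omega, vertical_of_frame (by omega) h4⟩, by omega⟩
  · refine Set.ncard_congr (fun p _ => (p : ℤ) - Y) ?_ ?_ ?_
    · rintro p ⟨h1, h2⟩
      have h3 := frame_of_vertical h2
      refine ⟨⟨?_, by omega⟩, by omega, h3⟩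
      by_contra h4
      exact frame_ne_red ha hsa le_rfl _ (not_lt.1 h4) h3
    · intro p p' _ _ h
      simpa using h
    · rintro i ⟨⟨h1, h2⟩, h3, h4⟩
      exact ⟨(i + Y).toNat, ⟨by omega, vertical_of_frame (by omega) h4⟩, by omega⟩

/-- The height function as a current of tagged particles in the box `(a, b]`. -/
lemma height_eq_of_frame_eq_colour {a b x : ℤ} {Y : ℕ} (ha : a < 0) (hb : 0 ≤ b) (hY : 0 ≤ a + Y)
    (hax : a ≤ x) (hxb : x ≤ b)
    (hsa : ∀ y < Y, 0 ≤ a + y → Silent δ₁ δ₂ u y a) (hsb : ∀ y < Y, Silent δ₁ δ₂ u y b)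
    {A : Set ℤ} {pos : ℤ → ℤ} (hpos : Set.InjOn pos A)
    (hbox : ∀ s, pos s ∈ Set.Ioc a b ↔ s ∈ Set.Ioc a b)
    (h : Set.EqOn (frame δ₁ δ₂ φ u Y) (colour A pos) (Set.Ioc a b)) :
    height δ₁ δ₂ φ u (x + Y) Y =
      ({s ∈ A ∩ Set.Ioc a b | s ≤ 0 ∧ x < pos s}.ncard : ℤ) -
        ({s ∈ A ∩ Set.Ioc a b | 0 < s ∧ pos s ≤ x}.ncard : ℤ) := by
  rw [height_eq_ncard ha hb hY hax hxb hsa hsb]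
  congr 2
  · symm
    refine Set.ncard_congr (fun s _ => pos s) ?_ ?_ ?_
    · rintro s ⟨⟨h1, h2⟩, h3, h4⟩
      refine ⟨(hbox s).2 h2, h4, ?_⟩
      rw [h ((hbox s).2 h2), colour_eq_blue hpos]
      exact ⟨s, h1, h3, rfl⟩
    · intro s s' hs hs' hss
      exact hpos hs.1.1 hs'.1.1 hss
    · rintro i ⟨h1, h2, h3⟩
      rw [h h1, colour_eq_blue hpos] at h3
      obtain ⟨s, h3, h4, rfl⟩ := h3
      exact ⟨s, ⟨⟨h3, (hbox s).1 h1⟩, h4, h2⟩, rfl⟩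
  · symm
    refine Set.ncard_congr (fun s _ => pos s) ?_ ?_ ?_
    · rintro s ⟨⟨h1, h2⟩, h3, h4⟩
      refine ⟨(hbox s).2 h2, h4, ?_⟩
      rw [h ((hbox s).2 h2), colour_eq_red]
      exact ⟨s, h1, h3, rfl⟩
    · intro s s' hs hs' hss
      exact hpos hs.1.1 hs'.1.1 hss
    · rintro i ⟨h1, h2, h3⟩
      rw [h h1, colour_eq_red] at h3
      obtain ⟨s, h3, h4, rfl⟩ := h3
      exact ⟨s, ⟨⟨h3, (hbox s).1 h1⟩, h4, h2⟩, rfl⟩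

end SixVertex

end VertexASEP

/-! ### The exclusion process between two inactive edges -/

namespace VertexASEP

/-- No instruction of `G` up to time `t` concerns the edge `(a, a + 1)`. -/
def Inactive (G : Set Instruction) (t : ℝ) (a : ℤ) : Prop :=
  ∀ e ∈ G, e.time ≤ t → (e.source ≤ a ↔ e.target ≤ a)

/-- A locally finite set of jump instructions with inactive edges arbitrarily far to the left and
to the right. -/
structure Harris (G : Set Instruction) (t : ℝ) : Prop where
  finite : ∀ N : ℕ, {e ∈ G | e.time ≤ t ∧ |e.source| ≤ (N : ℤ)}.Finite
  exists_le : ∀ m : ℤ, ∃ a ≤ m, Inactive G t a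
  exists_ge : ∀ m : ℤ, ∃ b ≥ m, Inactive G t b

variable {G : Set Instruction} {t : ℝ}

lemma Harris.finite_box (hG : Harris G t) (a b : ℤ) :
    {e ∈ G | e.time ≤ t ∧ e.source ∈ Set.Ioc a b}.Finite := by
  refine (hG.finite (max a.natAbs b.natAbs)).subset ?_
  rintro e ⟨h1, h2, h3, h4⟩
  refine ⟨h1, h2, abs_le.2 ⟨?_, ?_⟩⟩ <;> omega

open scoped Classical in
/-- The instructions up to time `t` with source in `(a, b]`, in the order of their times. -/
noncomputable def boxList (G : Set Instruction) (t : ℝ) (a b : ℤ) : List Instruction :=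
  if h : {e ∈ G | e.time ≤ t ∧ e.source ∈ Set.Ioc a b}.Finite then h.toFinset.sort (· ≤ ·) else []

lemma Harris.mem_boxList (hG : Harris G t) {a b : ℤ} {e : Instruction} :
    e ∈ boxList G t a b ↔ e ∈ G ∧ e.time ≤ t ∧ e.source ∈ Set.Ioc a b := by
  rw [boxList, dif_pos (hG.finite_box a b), Finset.mem_sort, Set.Finite.mem_toFinset]
  rfl

lemma Harris.pairwise_boxList (hG : Harris G t) (a b : ℤ) :
    (boxList G t a b).Pairwise (· < ·) := by
  rw [boxList, dif_pos (hG.finite_box a b)]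
  exact Finset.sortedLT_sort _ |>.pairwise

lemma Inactive.source_mem_iff {a b : ℤ} (ha : Inactive G t a) (hb : Inactive G t b)
    {e : Instruction} (he : e ∈ G) (het : e.time ≤ t) :
    e.source ∈ Set.Ioc a b ↔ e.target ∈ Set.Ioc a b := by
  have h1 := ha e he het
  have h2 := hb e he het
  simp only [Set.mem_Ioc, ← not_le, h1, h2]

lemma Harris.foldl_boxList_mem_iff (hG : Harris G t) {a b : ℤ} (ha : Inactive G t a)
    (hb : Inactive G t b) (A : Set ℤ) (s : ℤ) :
    (boxList G t a b).foldl (execute A) id s ∈ Set.Ioc a b ↔ s ∈ Set.Ioc a b :=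
  foldl_execute_mem_iff (fun _ he =>
    have he := hG.mem_boxList.1 he
    ha.source_mem_iff hb he.1 he.2.1) s

/-- Between two inactive edges, the exclusion process is the execution of the finitely many
instructions between these edges. -/
lemma Harris.position_eq (hG : Harris G t) {a b : ℤ} (ha : Inactive G t a) (hb : Inactive G t b)
    (A : Set ℤ) {s : ℤ} (hs : s ∈ Set.Ioc a b) :
    position G A t s = (boxList G t a b).foldl (execute A) id s := by
  classical
  refine Tendsto.limUnder_eq (tendsto_const_nhds.congr' ?_)
  filter_upwards [eventually_ge_atTop (max a.natAbs b.natAbs)] with N hN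
  rw [boundedPosition, dif_pos (hG.finite N)]
  have key := (foldl_execute_filter (A := A) (I := Set.Ioc a b)
    (l := (hG.finite N).toFinset.sort (· ≤ ·)) (pos := id) (pos' := id) (fun e he => by
      rw [Finset.mem_sort, Set.Finite.mem_toFinset] at he
      exact ha.source_mem_iff hb he.1 he.2.1) (fun _ => Iff.rfl) (fun _ => Iff.rfl)
      (fun _ _ => rfl)).2 hs
  have hbox : (hG.finite N).toFinset.filter (fun e => e.source ∈ Set.Ioc a b) =
      (hG.finite_box a b).toFinset := by
    ext e
    simp only [Set.Finite.mem_toFinset, Finset.mem_filter, Set.mem_ofPred_eq, Set.mem_Ioc]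
    constructor
    · rintro ⟨⟨h1, h2, -⟩, h3⟩
      exact ⟨h1, h2, h3⟩
    · rintro ⟨h1, h2, h3, h4⟩
      refine ⟨⟨h1, h2, abs_le.2 ⟨?_, ?_⟩⟩, h3, h4⟩ <;> omega
  rw [key, filter_sort_eq, hbox, boxList, dif_pos (hG.finite_box a b)]

lemma Harris.position_le_iff (hG : Harris G t) {a : ℤ} (ha : Inactive G t a) (A : Set ℤ) (s : ℤ) :
    position G A t s ≤ a ↔ s ≤ a := by
  obtain ⟨a', ha', h1⟩ := hG.exists_le (min a (s - 1))
  obtain ⟨b', hb', h2⟩ := hG.exists_ge (max a s)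
  rcases le_or_gt s a with h | h
  · have hs : s ∈ Set.Ioc a' a := ⟨by omega, h⟩
    have := (hG.foldl_boxList_mem_iff h1 ha A s).2 hs
    rw [hG.position_eq h1 ha A hs]
    exact iff_of_true this.2 h
  · have hs : s ∈ Set.Ioc a b' := ⟨by omega, by omega⟩
    have := (hG.foldl_boxList_mem_iff ha h2 A s).2 hs
    rw [hG.position_eq ha h2 A hs]
    exact iff_of_false (not_le.2 this.1) (not_le.2 h)

/-- The current through `x` as a current of tagged particles in the box `(a, b]`. -/
lemma current_eq_ncard {L R : ℝ} {φ : ℕ → Bool × Bool} {w : Waiting}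
    (hG : Harris (timeGraph L R w) t) {a b x : ℤ} (ha : Inactive (timeGraph L R w) t a)
    (hb : Inactive (timeGraph L R w) t b) (ha0 : a ≤ 0) (hb0 : 0 ≤ b) (hax : a ≤ x) (hxb : x ≤ b) :
    current L R φ w t x =
      ({s ∈ occupied φ ∩ Set.Ioc a b | s ≤ 0 ∧
        x < (boxList (timeGraph L R w) t a b).foldl (execute (occupied φ)) id s}.ncard : ℤ) -
      ({s ∈ occupied φ ∩ Set.Ioc a b | 0 < s ∧
        (boxList (timeGraph L R w) t a b).foldl (execute (occupied φ)) id s ≤ x}.ncard : ℤ) := by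
  classical
  set G := timeGraph L R w
  set A := occupied φ
  set S : Finset ℤ := (Finset.Ioc a b).filter (· ∈ A) with hS
  unfold current
  rw [finsum_mem_eq_sum_of_inter_support_eq (t := S)]
  · rw [Finset.sum_sub_distrib]
    have hpos : ∀ s ∈ S, position G A t s = (boxList G t a b).foldl (execute A) id s := by
      intro s hs
      rw [hS, Finset.mem_filter, Finset.mem_Ioc] at hs
      exact hG.position_eq ha hb A hs.1
    congr 1
    · simp only [ite_zero_mul_ite_zero, mul_one, Finset.sum_boole]
      rw [← Set.ncard_coe_finset]
      congr 2
      ext s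
      simp only [Finset.coe_filter, Set.mem_ofPred_eq]
      constructor
      · rintro ⟨h1, h2, h3⟩
        rw [hpos s h1] at h3
        simp only [hS, Finset.mem_filter, Finset.mem_Ioc] at h1
        exact ⟨⟨h1.2, h1.1⟩, h2, h3⟩
      · rintro ⟨⟨h1, h2⟩, h3, h4⟩
        have h5 : s ∈ S := by simpa [hS] using ⟨h2, h1⟩
        rw [← hpos s h5] at h4
        exact ⟨h5, h3, h4⟩
    · simp only [ite_zero_mul_ite_zero, mul_one, Finset.sum_boole]
      rw [← Set.ncard_coe_finset]
      congr 2
      ext s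
      simp only [Finset.coe_filter, Set.mem_ofPred_eq]
      constructor
      · rintro ⟨h1, h2, h3⟩
        rw [hpos s h1] at h3
        simp only [hS, Finset.mem_filter, Finset.mem_Ioc] at h1
        exact ⟨⟨h1.2, h1.1⟩, h2, h3⟩
      · rintro ⟨⟨h1, h2⟩, h3, h4⟩
        have h5 : s ∈ S := by simpa [hS] using ⟨h2, h1⟩
        rw [← hpos s h5] at h4
        exact ⟨h5, h3, h4⟩
  · ext s
    simp only [Set.mem_inter_iff, hS, Finset.coe_filter, Finset.mem_Ioc, Set.mem_ofPred_eq]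
    refine ⟨fun ⟨h1, h2⟩ => ⟨⟨?_, h1⟩, h2⟩, fun ⟨h1, h2⟩ => ⟨h1.2, h2⟩⟩
    -- Particles that start outside of the box stay on their side of it.
    rw [Function.mem_support] at h2
    by_contra h3
    apply h2
    rcases le_or_gt s a with h | h
    · have := (hG.position_le_iff ha A s).2 h
      rw [if_neg (show ¬ 0 < s by omega), if_neg (show ¬ x < position G A t s by omega)]
      simp
    · have hsb : b < s := by omega
      have := mt (hG.position_le_iff hb A s).1 (by omega)
      rw [if_neg (show ¬ s ≤ 0 by omega), if_neg (show ¬ position G A t s ≤ x by omega)]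
      simp

end VertexASEP

/-! ### Discretized clocks -/

namespace VertexASEP

/-- The rate of each of the two clocks of a site. -/
def rate (L R : ℝ) : Direction → ℝ
  | .left => L
  | .right => R

/-- The displacement that belongs to a direction. -/
def step : Direction → ℤ
  | .left => -1
  | .right => 1

/-- The time, in units of the mean waiting time, of the `n`-th ring of a clock. -/
noncomputable def arrival (w : ℕ → ℝ) (n : ℕ) : ℝ := ∑ m ∈ Finset.range (n + 1), w m

/-- The geometric variable of parameter `p` that is obtained by rounding up an exponential variable
in units of `-log (1 - p)`. -/
noncomputable def gap (p W : ℝ) : ℕ := ⌊W / (-Real.log (1 - p))⌋₊ + 1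

/-- The row of the `n`-th ring of the discretized clock of parameter `p`. -/
noncomputable def discreteArrival (p : ℝ) (w : ℕ → ℝ) (n : ℕ) : ℕ :=
  ∑ m ∈ Finset.range (n + 1), gap p (w m)

open scoped Classical in
/-- Whether the discretized clock of parameter `p` rings in row `k + 1`. For `p = 0` it never
rings. -/
noncomputable def bit (p : ℝ) (w : ℕ → ℝ) (k : ℕ) : Bool :=
  decide (0 < p ∧ ∃ n, discreteArrival p w n = k + 1)

lemma bit_eq_true {p : ℝ} {w : ℕ → ℝ} {k : ℕ} :
    bit p w k = true ↔ 0 < p ∧ ∃ n, discreteArrival p w n = k + 1 := by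
  simp [bit]

lemma strictMono_arrival {w : ℕ → ℝ} (hw : ∀ n, 0 < w n) : StrictMono (arrival w) :=
  strictMono_nat_of_lt_succ fun n => by
    rw [arrival, arrival, Finset.sum_range_succ _ (n + 1)]
    linarith [hw (n + 1)]

lemma arrival_pos {w : ℕ → ℝ} (hw : ∀ n, 0 < w n) (n : ℕ) : 0 < arrival w n :=
  Finset.sum_pos (fun m _ => hw m) ⟨0, by simp⟩

lemma le_arrival {w : ℕ → ℝ} (hw : ∀ n, 0 < w n) (n : ℕ) : w 0 ≤ arrival w n := by
  have := (strictMono_arrival hw).monotone (Nat.zero_le n)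
  simpa [arrival] using this

lemma strictMono_discreteArrival (p : ℝ) (w : ℕ → ℝ) : StrictMono (discreteArrival p w) :=
  strictMono_nat_of_lt_succ fun n => by
    rw [discreteArrival, discreteArrival, Finset.sum_range_succ _ (n + 1)]
    simp [gap]

lemma tendsto_mul_discreteArrival {c : ℝ} (hc : 0 < c) {w : ℕ → ℝ} (hw : ∀ n, 0 < w n) (n : ℕ) :
    Tendsto (fun ε : ℝ => ε * (discreteArrival (ε * c) w n : ℝ)) (𝓝[>] 0)
      (𝓝 (arrival w n / c)) := by
  set lam : ℝ → ℝ := fun ε => -Real.log (1 - ε * c) with hlam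
  have hderiv : HasDerivAt lam c 0 := by
    have h1 : HasDerivAt (fun ε : ℝ => 1 - ε * c) (-c) 0 := by
      simpa using ((hasDerivAt_id (0 : ℝ)).mul_const c).const_sub 1
    have h2 : HasDerivAt lam (-(-c / (1 - 0 * c))) 0 := (h1.log (by simp)).neg
    simpa using h2
  have hratio : Tendsto (fun ε => lam ε / ε) (𝓝[>] 0) (𝓝 c) := by
    have h := hasDerivAt_iff_tendsto_slope.1 hderiv
    have h' := h.mono_left (nhdsWithin_mono _ fun y (hy : (0 : ℝ) < y) => hy.ne')
    refine h'.congr fun ε => ?_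
    simp [slope, hlam, div_eq_inv_mul]
  have hpos : ∀ᶠ ε in 𝓝[>] (0 : ℝ), 0 < ε := eventually_mem_nhdsWithin
  have hlampos : ∀ᶠ ε in 𝓝[>] (0 : ℝ), 0 < lam ε := by
    filter_upwards [hratio.eventually (lt_mem_nhds hc), hpos] with ε h1 h2
    exact (div_pos_iff_of_pos_right h2).1 h1
  have hlam0 : Tendsto lam (𝓝[>] 0) (𝓝[>] 0) := by
    refine tendsto_nhdsWithin_iff.2 ⟨?_, hlampos⟩
    have := hderiv.continuousAt.tendsto.mono_left (nhdsWithin_le_nhds (s := Set.Ioi 0))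
    simpa [hlam] using this
  have hinv : Tendsto (fun ε => ε / lam ε) (𝓝[>] 0) (𝓝 c⁻¹) := by
    refine (hratio.inv₀ hc.ne').congr fun ε => ?_
    rw [inv_div]
  have hgap : ∀ W : ℝ, 0 < W →
      Tendsto (fun ε : ℝ => ε * (gap (ε * c) W : ℝ)) (𝓝[>] 0) (𝓝 (W / c)) := by
    intro W hW
    have h1 := (tendsto_nat_floor_mul_div_atTop hW.le).comp (tendsto_inv_nhdsGT_zero.comp hlam0)
    have h2 := h1.mul hinv
    have h3 : Tendsto (fun ε : ℝ => ε) (𝓝[>] 0) (𝓝 0) := nhdsWithin_le_nhds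
    have h4 := h2.add h3
    rw [add_zero, ← div_eq_mul_inv] at h4
    refine h4.congr' ?_
    filter_upwards [hlampos] with ε h5
    simp only [gap, Function.comp, div_inv_eq_mul, Nat.cast_add, Nat.cast_one]
    rw [← div_eq_mul_inv, show -Real.log (1 - ε * c) = lam ε from rfl]
    field_simp
  have hsum := tendsto_finsetSum (Finset.range (n + 1)) fun m _ => hgap (w m) (hw m)
  rw [← Finset.sum_div] at hsum
  refine hsum.congr fun ε => ?_
  rw [discreteArrival, Nat.cast_sum, Finset.mul_sum]

/-- The properties of almost every sample of the clocks that are used: all waiting times are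
positive, no clock explodes, no ring occurs at time `t`, no two clocks ring simultaneously, and there
are edges without rings up to time `t` arbitrarily far to the left and to the right. -/
structure Regular (L R t : ℝ) (w : Waiting) : Prop where
  pos : ∀ i d n, 0 < w i d n
  unbounded : ∀ i d c, ∃ n, c < arrival (w i d) n
  ne_time : ∀ i d n, arrival (w i d) n ≠ rate L R d * t
  ne_arrival : ∀ i d i' d', (i, d) ≠ (i', d') → 0 < rate L R d → 0 < rate L R d' → ∀ n n',
    rate L R d' * arrival (w i d) n ≠ rate L R d * arrival (w i' d') n'
  exists_le : ∀ m : ℤ, ∃ a ≤ m, R * t < w a .right 0 ∧ L * t < w (a + 1) .left 0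
  exists_ge : ∀ m : ℤ, ∃ b ≥ m, R * t < w b .right 0 ∧ L * t < w (b + 1) .left 0

lemma mem_timeGraph {L R : ℝ} {w : Waiting} {e : Instruction} :
    e ∈ timeGraph L R w ↔ ∃ d, e.target = e.source + step d ∧ 0 < e.time ∧
      ∃ n, rate L R d * e.time = arrival (w e.source d) n := by
  constructor
  · rintro ⟨t, i, ⟨⟨h1, n, h2⟩, rfl⟩ | ⟨⟨h1, n, h2⟩, rfl⟩⟩
    · exact ⟨.right, rfl, h1, n, h2⟩
    · exact ⟨.left, rfl, h1, n, h2⟩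
  · rintro ⟨d, h1, h2, n, h3⟩
    refine ⟨e.time, e.source, ?_⟩
    rcases d with _ | _
    · refine Or.inr ⟨⟨h2, n, h3⟩, ?_⟩
      rw [sub_eq_add_neg, ← e.eta]
      exact congrArg (instruction e.time e.source) h1
    · refine Or.inl ⟨⟨h2, n, h3⟩, ?_⟩
      rw [← e.eta]
      exact congrArg (instruction e.time e.source) h1

lemma step_injective : Function.Injective step := by
  rintro (_ | _) (_ | _) h <;> simp_all [step]

section

variable {L R t : ℝ} {w : Waiting}

lemma Regular.rate_pos (hw : Regular L R t w) {d : Direction} {i : ℤ} {T : ℝ} (hT : 0 < T) {n : ℕ}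
    (h : rate L R d * T = arrival (w i d) n) : 0 < rate L R d := by
  have := arrival_pos (hw.pos i d) n
  rw [← h] at this
  exact (pos_iff_pos_of_mul_pos this).2 hT

lemma inactive_of_lt (hL : 0 ≤ L) (hR : 0 ≤ R) (hpos : ∀ i d n, 0 < w i d n) {a : ℤ}
    (h : R * t < w a .right 0 ∧ L * t < w (a + 1) .left 0) :
    Inactive (timeGraph L R w) t a := by
  intro e he het
  obtain ⟨d, h1, -, n, h3⟩ := mem_timeGraph.1 he
  rw [h1]
  rcases d with _ | _ <;> simp only [step, rate] at *
  · have h4 : e.source ≠ a + 1 := by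
      intro h5
      rw [h5] at h3
      have := le_arrival (hpos (a + 1) .left) n
      nlinarith
    omega
  · have h4 : e.source ≠ a := by
      intro h5
      rw [h5] at h3
      have := le_arrival (hpos a .right) n
      nlinarith
    omega

lemma Regular.harris (hw : Regular L R t w) (hL : 0 ≤ L) (hR : 0 ≤ R) :
    Harris (timeGraph L R w) t where
  finite N := by
    choose n₀ hn₀ using fun (i : ℤ) (d : Direction) => hw.unbounded i d (rate L R d * t)
    have hd : (Set.univ : Set Direction).Finite :=
      (Set.toFinite {Direction.left, Direction.right}).subset fun d _ => by cases d <;> simp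
    refine ((Set.finite_Icc (-(N : ℤ)) N).biUnion fun i _ => hd.biUnion fun d _ =>
      (Set.finite_Iio (n₀ i d)).image fun n =>
        instruction (arrival (w i d) n / rate L R d) i (i + step d)).subset ?_
    rintro e ⟨he, het, heN⟩
    obtain ⟨d, h1, h2, n, h3⟩ := mem_timeGraph.1 he
    have hr := hw.rate_pos h2 h3
    simp only [Set.mem_iUnion, Set.mem_image, Set.mem_Icc, Set.mem_Iio, Set.mem_univ]
    refine ⟨e.source, abs_le.1 heN, d, trivial, n, ?_, ?_⟩
    · rw [← (strictMono_arrival (hw.pos e.source d)).lt_iff_lt, ← h3]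
      exact (mul_le_mul_of_nonneg_left het hr.le).trans_lt (hn₀ _ _)
    · rw [← h3, mul_div_cancel_left₀ _ hr.ne', ← h1]
      exact e.eta
  exists_le m := by
    obtain ⟨a, ha, h⟩ := hw.exists_le m
    exact ⟨a, ha, inactive_of_lt hL hR hw.pos h⟩
  exists_ge m := by
    obtain ⟨a, ha, h⟩ := hw.exists_ge m
    exact ⟨a, ha, inactive_of_lt hL hR hw.pos h⟩

end

/-! ### The coupling -/

/-- Selections in `{0, 1}` that are unlikely in the directions marked by `true`. -/
noncomputable def toSelection (b : Direction → Bool) : unitInterval × unitInterval :=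
  (if b .left then 0 else 1, if b .right then 0 else 1)

/-- The height function in terms of the marks `b (c, k)` of the vertices `(c, k + 1)`. -/
noncomputable def bitHeight (φ : ℕ → Bool × Bool) (b : ℕ × ℕ → Direction → Bool) (X : ℤ) (Y : ℕ) :
    ℤ :=
  height (1 / 2) (1 / 2) φ (fun q => toSelection (b (q.1, q.2 - 1))) X Y

/-- The marks of the vertices given by discretized clocks: the vertex `(c, k + 1)` belongs to the
edge `(i, i + 1)` with `i = c - (k + 1)`, and thus to the right clock of `i` and to the left clock of
`i + 1`. -/
noncomputable def coupledBits (L R ε : ℝ) (w : Waiting) : ℕ × ℕ → Direction → Bool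
  | (c, k), .left => bit (ε * L) (w (c - k) .left) k
  | (c, k), .right => bit (ε * R) (w (c - k - 1) .right) k

lemma toSelection_fst_lt {b : Direction → Bool} :
    ((toSelection b).1 : ℝ) < 1 / 2 ↔ b .left = true := by
  unfold toSelection
  cases b .left <;> simp
  norm_num

lemma toSelection_snd_lt {b : Direction → Bool} :
    ((toSelection b).2 : ℝ) < 1 / 2 ↔ b .right = true := by
  unfold toSelection
  cases b .right <;> simp
  norm_num

lemma Instruction.time_le_of_lt {e e' : Instruction} (h : e < e') : e.time ≤ e'.time := by
  rcases Prod.Lex.lt_iff.1 h with h | h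
  · exact h.le
  · exact h.1.le

/-- Almost surely, the height function of the coupled six-vertex model agrees with the current of
the exclusion process as soon as `ε` is small. -/
theorem Regular.eventually_bitHeight_eq {L R t : ℝ} {w : Waiting} (hw : Regular L R t w)
    (hL : 0 ≤ L) (hR : 0 ≤ R) (ht : 0 < t) (x : ℤ) :
    ∀ᶠ ε in 𝓝[>] (0 : ℝ), ∀ φ : ℕ → Bool × Bool,
      bitHeight φ (coupledBits L R ε w) (x + (⌊ε⁻¹ * t⌋₊ : ℤ)) ⌊ε⁻¹ * t⌋₊ =
        current L R φ w t x := by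
  have hG := hw.harris hL hR
  obtain ⟨a, hax, ha⟩ := hG.exists_le (min x (-1))
  obtain ⟨b, hbx, hb⟩ := hG.exists_ge (max x 0)
  set G := timeGraph L R w with hGdef
  set l := boxList G t a b with hl
  have hmem : ∀ e, e ∈ l ↔ e ∈ G ∧ e.time ≤ t ∧ e.source ∈ Set.Ioc a b :=
    fun e => hG.mem_boxList
  have : Nonempty Direction := ⟨.left⟩
  choose! dir hdir htime idx hidx using fun e (he : e ∈ G) => mem_timeGraph.1 he
  have hrate : ∀ e ∈ G, 0 < rate L R (dir e) := fun e he =>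
    hw.rate_pos (htime e he) (hidx e he)
  set ρ : ℝ → Instruction → ℕ := fun ε e =>
    discreteArrival (ε * rate L R (dir e)) (w e.source (dir e)) (idx e) with hρdef
  have hρ : ∀ e ∈ G, Tendsto (fun ε => ε * (ρ ε e : ℝ)) (𝓝[>] 0) (𝓝 e.time) := by
    intro e he
    have := tendsto_mul_discreteArrival (hrate e he) (hw.pos e.source (dir e)) (idx e)
    rwa [← hidx e he, mul_div_cancel_left₀ _ (hrate e he).ne'] at this
  have hpos : ∀ᶠ ε in 𝓝[>] (0 : ℝ), 0 < ε := eventually_mem_nhdsWithin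
  have hid : Tendsto (fun ε : ℝ => ε) (𝓝[>] 0) (𝓝 0) := nhdsWithin_le_nhds
  -- The order of the rings is eventually the order of their rows.
  have hmono : ∀ᶠ ε in 𝓝[>] (0 : ℝ), ∀ e ∈ l, ∀ e' ∈ l, e.time < e'.time → ρ ε e < ρ ε e' := by
    have : ∀ᶠ ε in 𝓝[>] (0 : ℝ), ∀ e ∈ l.toFinset, ∀ e' ∈ l.toFinset,
        e.time < e'.time → ρ ε e < ρ ε e' := by
      rw [Finset.eventually_all]
      intro e he
      rw [Finset.eventually_all]
      intro e' he'
      rw [List.mem_toFinset, hmem] at he he'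
      by_cases h : e.time < e'.time
      · filter_upwards [(hρ e he.1).eventually_lt (hρ e' he'.1) h, hpos] with ε h1 h2 _
        exact_mod_cast lt_of_mul_lt_mul_left h1 h2.le
      · exact Eventually.of_forall fun _ h' => absurd h' h
    simpa using this
  have hrow : ∀ᶠ ε in 𝓝[>] (0 : ℝ), ∀ e ∈ l, -a < ρ ε e ∧ ρ ε e ≤ ⌊ε⁻¹ * t⌋₊ := by
    have : ∀ᶠ ε in 𝓝[>] (0 : ℝ), ∀ e ∈ l.toFinset, -a < ρ ε e ∧ ρ ε e ≤ ⌊ε⁻¹ * t⌋₊ := by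
      rw [Finset.eventually_all]
      intro e he
      rw [List.mem_toFinset, hmem] at he
      have h1 : Tendsto (fun ε : ℝ => ε * (-a : ℝ)) (𝓝[>] 0) (𝓝 0) := by
        simpa using hid.mul_const (-a : ℝ)
      have h2 : e.time < t := by
        refine lt_of_le_of_ne he.2.1 fun h => ?_
        have h3 := hidx e he.1
        rw [h] at h3
        exact hw.ne_time _ _ _ h3.symm
      filter_upwards [h1.eventually_lt (hρ e he.1) (htime e he.1),
        (hρ e he.1).eventually (gt_mem_nhds h2), hpos] with ε h3 h4 h5
      refine ⟨?_, Nat.le_floor ?_⟩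
      · exact_mod_cast lt_of_mul_lt_mul_left h3 h5.le
      · rw [inv_mul_eq_div, le_div_iff₀' h5]
        exact h4.le
    simpa using this
  -- Rings after time `t` eventually belong to rows above `⌊t / ε⌋`.
  have hlate : ∀ᶠ ε in 𝓝[>] (0 : ℝ), ∀ i ∈ Finset.Icc a (b + 1), ∀ d, 0 < rate L R d → ∀ n,
      discreteArrival (ε * rate L R d) (w i d) n ≤ ⌊ε⁻¹ * t⌋₊ →
        arrival (w i d) n ≤ rate L R d * t := by
    rw [Finset.eventually_all]
    intro i _
    have key : ∀ d, ∀ᶠ ε in 𝓝[>] (0 : ℝ), 0 < rate L R d → ∀ n,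
        discreteArrival (ε * rate L R d) (w i d) n ≤ ⌊ε⁻¹ * t⌋₊ →
          arrival (w i d) n ≤ rate L R d * t := by
      intro d
      by_cases hd : 0 < rate L R d
      · classical
        have hex := hw.unbounded i d (rate L R d * t)
        have h1 := tendsto_mul_discreteArrival hd (hw.pos i d) (Nat.find hex)
        have h2 : t < arrival (w i d) (Nat.find hex) / rate L R d := by
          rw [lt_div_iff₀' hd]
          exact Nat.find_spec hex
        filter_upwards [h1.eventually (lt_mem_nhds h2), hpos] with ε h3 h4 _ n hn
        refine not_lt.1 (Nat.find_min hex ?_)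
        rw [← (strictMono_discreteArrival (ε * rate L R d) (w i d)).lt_iff_lt]
        refine hn.trans_lt ((Nat.floor_lt (by positivity)).2 ?_)
        rwa [inv_mul_eq_div, div_lt_iff₀' h4]
      · exact Eventually.of_forall fun _ h' => absurd h' hd
    filter_upwards [key .left, key .right] with ε h1 h2 d
    cases d
    · exact h1
    · exact h2
  have hY : ∀ᶠ ε in 𝓝[>] (0 : ℝ), 0 ≤ a + (⌊ε⁻¹ * t⌋₊ : ℤ) := by
    have h1 : Tendsto (fun ε : ℝ => ε⁻¹ * t) (𝓝[>] 0) atTop :=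
      tendsto_inv_nhdsGT_zero.atTop_mul_const ht
    filter_upwards [(tendsto_nat_floor_atTop.comp h1).eventually (eventually_ge_atTop a.natAbs)]
      with ε h2
    simp only [Function.comp] at h2
    omega
  filter_upwards [hpos, hmono, hrow, hlate, hY] with ε hε hmono hrow hlate hY φ
  set Y := ⌊ε⁻¹ * t⌋₊ with hYdef
  set u : ℕ × ℕ → unitInterval × unitInterval :=
    fun q => toSelection (coupledBits L R ε w (q.1, q.2 - 1)) with hu
  have hbit : ∀ (i : ℤ) (d : Direction), a ≤ i → i ≤ b + 1 → a ≤ i + step d →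
      i + step d ≤ b + 1 → ∀ y < Y, (bit (ε * rate L R d) (w i d) y = true ↔
        ∃ e ∈ l, ρ ε e = y + 1 ∧ e.source = i ∧ e.target = i + step d) := by
    intro i d hai hib hai' hib' y hy
    rw [bit_eq_true]
    constructor
    · rintro ⟨h1, n, hn⟩
      have hr : 0 < rate L R d := (pos_iff_pos_of_mul_pos h1).1 hε
      have h2 := hlate i (Finset.mem_Icc.2 ⟨hai, hib⟩) d hr n (by omega)
      set e := instruction (arrival (w i d) n / rate L R d) i (i + step d) with he
      have heG : e ∈ G := mem_timeGraph.2 ⟨d, rfl, div_pos (arrival_pos (hw.pos i d) n) hr, n,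
        mul_div_cancel₀ _ hr.ne'⟩
      have het : e.time ≤ t := (div_le_iff₀' hr).2 h2
      have hda := ha e heG het
      have hdb := hb e heG het
      have hed : dir e = d := step_injective (by
        have := hdir e heG
        simp only [he, source_instruction, target_instruction] at this ⊢
        omega)
      have hein : idx e = n := by
        have h3 := hidx e heG
        rw [hed] at h3
        apply (strictMono_arrival (hw.pos i d)).injective
        rw [show arrival (w i d) (idx e) = _ from h3.symm]
        exact mul_div_cancel₀ _ hr.ne'
      refine ⟨e, (hmem e).2 ⟨heG, het, ?_⟩, ?_, rfl, rfl⟩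
      · have hstep : step d = 1 ∨ step d = -1 := by cases d <;> simp [step]
        simp only [he, source_instruction, target_instruction] at hda hdb ⊢
        constructor <;> omega
      · simp only [hρdef, hed, hein]
        exact hn
    · rintro ⟨e, he, h1, h2, h3⟩
      have heG := ((hmem e).1 he).1
      have hed : dir e = d := step_injective (by
        have := hdir e heG
        omega)
      refine ⟨mul_pos hε (hed ▸ hrate e heG), idx e, ?_⟩
      rw [← h1, ← h2, ← hed]
  have hbox : ∀ e ∈ l, e.source ∈ Set.Ioc a b ∧ e.target ∈ Set.Ioc a b := by
    intro e he
    obtain ⟨h1, h2, h3⟩ := (hmem e).1 he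
    exact ⟨h3, (ha.source_mem_iff hb h1 h2).1 h3⟩
  have hnn : ∀ e ∈ l, e.target = e.source + 1 ∨ e.source = e.target + 1 := by
    intro e he
    have h1 := hdir e ((hmem e).1 he).1
    cases h2 : dir e <;> rw [h2] at h1 <;> simp only [step] at h1 <;> omega
  have hsel : ∀ (y : ℕ) (j : ℤ),
      selection u y j = toSelection (coupledBits L R ε w ((j + y + 1).toNat, y)) := fun _ _ => rfl
  have hright : ∀ y < Y, ∀ j, a ≤ j → j ≤ b → 0 ≤ j + y →
      (((selection u y j).2 : ℝ) < 1 / 2 ↔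
        ∃ e ∈ l, ρ ε e = y + 1 ∧ e.source = j ∧ e.target = j + 1) := by
    intro y hy j h1 h2 h3
    rw [hsel y j, toSelection_snd_lt, coupledBits,
      show (((j + y + 1).toNat : ℕ) : ℤ) - y - 1 = j by omega]
    exact hbit j .right h1 (by omega) (by simp [step]; omega) (by simp [step]; omega) y hy
  have hleft : ∀ y < Y, ∀ j, a ≤ j → j ≤ b → 0 ≤ j + y →
      (((selection u y j).1 : ℝ) < 1 / 2 ↔
        ∃ e ∈ l, ρ ε e = y + 1 ∧ e.source = j + 1 ∧ e.target = j) := by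
    intro y hy j h1 h2 h3
    rw [hsel y j, toSelection_fst_lt, coupledBits,
      show (((j + y + 1).toNat : ℕ) : ℤ) - y = j + 1 by omega]
    have h := hbit (j + 1) .left (by omega) (by omega) (by simp [step]; omega)
      (by simp [step]; omega) y hy
    rw [show j + 1 + step .left = j by simp [step]] at h
    exact h
  have hpw : l.Pairwise fun e e' => ρ ε e < ρ ε e' := by
    refine (hG.pairwise_boxList a b).imp_of_mem fun {e e'} he he' hlt => ?_
    refine hmono e he e' he' (lt_of_le_of_ne (Instruction.time_le_of_lt hlt) fun h => ?_)
    have h1 := ((hmem e).1 he).1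
    have h2 := ((hmem e').1 he').1
    by_cases hc : (e.source, dir e) = (e'.source, dir e')
    · obtain ⟨h3, h4⟩ := Prod.mk.inj hc
      apply hlt.ne
      rw [← e.eta, ← e'.eta, hdir e h1, hdir e' h2, h, h3, h4]
    · refine hw.ne_arrival _ _ _ _ hc (hrate e h1) (hrate e' h2) (idx e) (idx e') ?_
      rw [← hidx e h1, ← hidx e' h2, h]
      ring
  have hsilent : ∀ j, (j = a ∨ j = b) → ∀ y < Y, 0 ≤ j + (y : ℤ) →
      Silent (1 / 2) (1 / 2) u y j := by
    intro j hj y hy h3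
    refine ⟨not_lt.1 fun h => ?_, not_lt.1 fun h => ?_⟩
    · obtain ⟨e, he, -, h4, h5⟩ := (hleft y hy j (by omega) (by omega) h3).1 h
      have := hbox e he
      simp only [Set.mem_Ioc] at this
      omega
    · obtain ⟨e, he, -, h4, h5⟩ := (hright y hy j (by omega) (by omega) h3).1 h
      have := hbox e he
      simp only [Set.mem_Ioc] at this
      omega
  have hframe := frame_eqOn_foldl (φ := φ) (by omega) hpw hbox (fun e he => (hrow e he).1) hnn
    hright hleft le_rfl
  have hfilter : (l.filter fun e => ρ ε e ≤ Y) = l :=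
    List.filter_eq_self.2 fun e he => by simpa using (hrow e he).2
  rw [hfilter, frame_zero, ← colour_foldl_execute] at hframe
  rw [current_eq_ncard hG ha hb (by omega) (by omega) (by omega) (by omega)]
  exact height_eq_of_frame_eq_colour (by omega) (by omega) hY (by omega) (by omega)
    (fun y hy h => hsilent a (Or.inl rfl) y hy h)
    (fun y hy => hsilent b (Or.inr rfl) y hy (by omega))
    (injOn_foldl_execute l (Set.injOn_id _)) (fun s => hG.foldl_boxList_mem_iff ha hb _ s) hframe

end VertexASEP

/-! ### The discretized clocks are Bernoulli sequences -/

namespace VertexASEP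

instance : IsProbabilityMeasure (expMeasure 1) := isProbabilityMeasure_expMeasure one_pos

instance : NullSingletonClass (expMeasure 1) := by
  unfold expMeasure gammaMeasure
  infer_instance

lemma expMeasure_Ici {x : ℝ} (hx : 0 ≤ x) :
    expMeasure 1 (Set.Ici x) = ENNReal.ofReal (Real.exp (-x)) := by
  have h1 : expMeasure 1 (Set.Iic x) = ENNReal.ofReal (1 - Real.exp (-x)) := by
    rw [← ofReal_cdf, cdf_expMeasure_eq one_pos, if_pos hx, one_mul]
  have h2 : Real.exp (-x) ≤ 1 := Real.exp_le_one_iff.2 (by linarith)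
  rw [← measure_congr Ioi_ae_eq_Ici, ← Set.compl_Iic, prob_compl_eq_one_sub measurableSet_Iic, h1,
    ← ENNReal.ofReal_one, ← ENNReal.ofReal_sub _ (by linarith), sub_sub_cancel]

lemma measurable_gap (p : ℝ) : Measurable (gap p) := by
  unfold gap
  exact (Nat.measurable_floor.comp (measurable_id.div_const _)).add_const 1

lemma expMeasure_lt_gap {p : ℝ} (h0 : 0 < p) (h1 : p < 1) (d : ℕ) :
    expMeasure 1 {W | d < gap p W} = ENNReal.ofReal ((1 - p) ^ d) := by
  rcases Nat.eq_zero_or_pos d with rfl | hd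
  · have : {W : ℝ | 0 < gap p W} = Set.univ := by
      ext W
      simp [gap]
    rw [this]
    simp
  · have hlog : 0 < -Real.log (1 - p) := neg_pos.2 (Real.log_neg (by linarith) (by linarith))
    have : {W : ℝ | d < gap p W} = Set.Ici (d * (-Real.log (1 - p))) := by
      ext W
      rw [Set.mem_ofPred_eq, gap, Nat.lt_succ_iff, Nat.le_floor_iff' hd.ne', Set.mem_Ici,
        le_div_iff₀ hlog]
    rw [this, expMeasure_Ici (by positivity)]
    congr 1
    rw [mul_neg, neg_neg, Real.exp_nat_mul, Real.exp_log (by linarith)]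

lemma expMeasure_gap_eq {p : ℝ} (h0 : 0 < p) (h1 : p < 1) (d : ℕ) :
    expMeasure 1 {W | gap p W = d + 1} = ENNReal.ofReal ((1 - p) ^ d * p) := by
  have hset : {W | gap p W = d + 1} = {W | d < gap p W} \ {W | d + 1 < gap p W} := by
    ext W
    simp only [Set.mem_ofPred_eq, Set.mem_sdiff]
    omega
  rw [hset, measure_sdiff
    (show {W | d + 1 < gap p W} ⊆ {W | d < gap p W} from fun W => Nat.lt_of_succ_lt)
    (measurableSet_lt measurable_const (measurable_gap p)).nullMeasurableSet
    (measure_ne_top _ _), expMeasure_lt_gap h0 h1, expMeasure_lt_gap h0 h1,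
    ← ENNReal.ofReal_sub _ (by have := sub_pos.2 h1; positivity)]
  congr 1
  ring

/-- The law on `Bool` with mass `p` at `true`, as the law of the mark of a selection. -/
noncomputable def bern (p : ℝ) : Measure Bool :=
  (volume : Measure unitInterval).map fun v : unitInterval => decide ((v : ℝ) < p)

lemma measurable_decide_lt (p : ℝ) : Measurable fun v : unitInterval => decide ((v : ℝ) < p) :=
  measurable_to_bool (by
    simpa [Set.preimage] using measurableSet_lt measurable_subtype_coe measurable_const)

instance (p : ℝ) : IsProbabilityMeasure (bern p) :=
  Measure.isProbabilityMeasure_map (measurable_decide_lt p).aemeasurable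

lemma bern_true {p : ℝ} (h0 : 0 ≤ p) (h1 : p ≤ 1) : bern p {true} = ENNReal.ofReal p := by
  rw [bern, Measure.map_apply (measurable_decide_lt p) (by simp)]
  have : (fun v : unitInterval => decide ((v : ℝ) < p)) ⁻¹' {true} =
      Set.Iio (⟨p, h0, h1⟩ : unitInterval) := by
    ext v
    simp [← Subtype.coe_lt_coe]
  rw [this, unitInterval.volume_Iio]

lemma bern_false {p : ℝ} (h0 : 0 ≤ p) (h1 : p ≤ 1) : bern p {false} = ENNReal.ofReal (1 - p) := by
  have : ({false} : Set Bool) = {true}ᶜ := by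
    ext b
    cases b <;> simp
  rw [this, prob_compl_eq_one_sub (by simp), bern_true h0 h1, ← ENNReal.ofReal_one,
    ← ENNReal.ofReal_sub _ h0]

lemma bern_zero : bern 0 = Measure.dirac false := by
  unfold bern
  have : (fun v : unitInterval => decide ((v : ℝ) < 0)) = fun _ => false := by
    funext v
    simpa using v.2.1
  rw [this, Measure.map_const]
  simp

/-- A measure on sequences in a countable space is a product measure if this is so for the probability
of each initial segment. -/
lemma eq_infinitePi_of_prefix {X : Type*} [MeasurableSpace X] [Countable X]
    [MeasurableSingletonClass X] (μ : Measure X) [IsProbabilityMeasure μ] (ν : Measure (ℕ → X))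
    (h : ∀ (N : ℕ) (a : ℕ → X), ν {x | ∀ k < N, x k = a k} = ∏ k ∈ Finset.range N, μ {a k}) :
    ν = Measure.infinitePi fun _ => μ := by
  have hν : IsProbabilityMeasure ν := by
    refine ⟨?_⟩
    obtain ⟨a⟩ := nonempty_of_isProbabilityMeasure μ
    simpa using h 0 fun _ => a
  refine ((Measure.isProjectiveLimit_infinitePi (fun _ : ℕ => μ)).unique ?_).symm
  refine (isProjectiveLimit_nat_iff (isProjectiveMeasureFamily_pi fun _ : ℕ => μ) ν).2 fun n => ?_
  refine Measure.ext_of_singleton fun a => ?_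
  rw [Measure.map_apply (by fun_prop) (MeasurableSet.singleton a), Measure.pi_singleton]
  set a' : ℕ → X := fun k => if hk : k ∈ Finset.Iic n then a ⟨k, hk⟩ else a ⟨0, by simp⟩ with ha'
  have hset : Preorder.frestrictLe (π := fun _ : ℕ => X) n ⁻¹' {a} =
      {x | ∀ k < n + 1, x k = a' k} := by
    ext x
    simp only [Set.mem_preimage, Set.mem_singleton_iff, Set.mem_ofPred_eq, funext_iff,
      Subtype.forall]
    refine forall_congr' fun k => ?_
    simp only [Finset.mem_Iic, Nat.lt_succ_iff]
    refine forall_congr' fun hk => ?_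
    simp [ha', hk]
  rw [hset, h]
  have : Finset.range (n + 1) = Finset.Iic n := by
    ext k
    simp
  rw [this, ← Finset.prod_coe_sort]
  exact Finset.prod_congr rfl fun k _ => by rw [show a' k = a k from dif_pos k.2]

/-- Each initial segment of the marks of a discretized clock is a condition on finitely many gaps:
the gaps up to the last ring are prescribed, and the next gap exceeds the rest. -/
lemma exists_gaps_of_bits {p : ℝ} (h0 : 0 < p) (h1 : p < 1) (a : ℕ → Bool) (N : ℕ) :
    ∃ (n d : ℕ) (g : ℕ → ℕ),
      (∀ w : ℕ → ℝ, (∀ k < N, bit p w k = a k) ↔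
        (∀ m < n, gap p (w m) = g m) ∧ d < gap p (w n)) ∧
      ∑ m ∈ Finset.range n, g m + d = N ∧
      (∏ m ∈ Finset.range n, expMeasure 1 {W | gap p W = g m}) * expMeasure 1 {W | d < gap p W} =
        ∏ k ∈ Finset.range N, bern p {a k} := by
  induction N with
  | zero =>
    refine ⟨0, 0, fun _ => 0, fun w => ?_, by simp, ?_⟩
    · simp [gap]
    · rw [expMeasure_lt_gap h0 h1]
      simp
  | succ N ih =>
    obtain ⟨n, d, g, hev, hsum, hprod⟩ := ih
    have hbit : ∀ w : ℕ → ℝ, (∀ m < n, gap p (w m) = g m) → d < gap p (w n) →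
        (bit p w N = true ↔ gap p (w n) = d + 1) := by
      intro w hw hd
      have hn : discreteArrival p w n + d = N + gap p (w n) := by
        have hS : ∑ m ∈ Finset.range n, gap p (w m) = ∑ m ∈ Finset.range n, g m :=
          Finset.sum_congr rfl fun m hm => hw m (Finset.mem_range.1 hm)
        rw [discreteArrival, Finset.sum_range_succ, hS]
        omega
      rw [bit_eq_true]
      constructor
      · rintro ⟨-, n', hn'⟩
        rcases lt_trichotomy n' n with h | rfl | h
        · have h2 : discreteArrival p w n' + gap p (w n) ≤ discreteArrival p w n := by
            rw [discreteArrival, discreteArrival, Finset.sum_range_succ _ n]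
            exact Nat.add_le_add_right (Finset.sum_le_sum_of_subset
              (Finset.range_subset_range.2 h)) _
          omega
        · omega
        · have := strictMono_discreteArrival p w h
          omega
      · intro h
        exact ⟨h0, n, by omega⟩
    have hsucc : ∀ w : ℕ → ℝ, (∀ k < N + 1, bit p w k = a k) ↔
        ((∀ m < n, gap p (w m) = g m) ∧ d < gap p (w n)) ∧ bit p w N = a N := by
      intro w
      rw [← hev w]
      exact Nat.forall_lt_succ_right
    cases haN : a N with
    | true =>
      refine ⟨n + 1, 0, fun m => if m = n then d + 1 else g m, fun w => ?_, ?_, ?_⟩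
      · rw [hsucc, haN, Nat.forall_lt_succ_right]
        have hg : (∀ m < n, gap p (w m) = if m = n then d + 1 else g m) ↔
            ∀ m < n, gap p (w m) = g m :=
          forall₂_congr fun m hm => by rw [if_neg hm.ne]
        dsimp only
        rw [hg, if_pos rfl]
        constructor
        · rintro ⟨⟨h2, h3⟩, h4⟩
          exact ⟨⟨h2, (hbit w h2 h3).1 h4⟩, by simp [gap]⟩
        · rintro ⟨⟨h2, h3⟩, -⟩
          have h4 : d < gap p (w n) := by omega
          exact ⟨⟨h2, h4⟩, (hbit w h2 h4).2 h3⟩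
      · have hS : ∑ m ∈ Finset.range n, (if m = n then d + 1 else g m) =
            ∑ m ∈ Finset.range n, g m :=
          Finset.sum_congr rfl fun m hm => if_neg (Finset.mem_range.1 hm).ne
        rw [Finset.sum_range_succ, hS, if_pos rfl]
        omega
      · dsimp only
        rw [Finset.prod_range_succ _ n, Finset.prod_range_succ _ N, ← hprod, haN, if_pos rfl,
          bern_true h0.le h1.le, expMeasure_gap_eq h0 h1, expMeasure_lt_gap h0 h1,
          expMeasure_lt_gap h0 h1, ENNReal.ofReal_mul (by have := sub_pos.2 h1; positivity),
          Finset.prod_congr rfl fun m hm => by rw [if_neg (Finset.mem_range.1 hm).ne]]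
        simp [mul_assoc]
    | false =>
      refine ⟨n, d + 1, g, fun w => ?_, by omega, ?_⟩
      · rw [hsucc, haN]
        constructor
        · rintro ⟨⟨h2, h3⟩, h4⟩
          have h5 : gap p (w n) ≠ d + 1 := fun h => by
            rw [(hbit w h2 h3).2 h] at h4
            cases h4
          exact ⟨h2, by omega⟩
        · rintro ⟨h2, h3⟩
          have h4 : d < gap p (w n) := by omega
          refine ⟨⟨h2, h4⟩, ?_⟩
          rw [← Bool.not_eq_true, hbit w h2 h4]
          omega
      · rw [Finset.prod_range_succ _ N, ← hprod, haN, bern_false h0.le h1.le,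
          expMeasure_lt_gap h0 h1, expMeasure_lt_gap h0 h1, pow_succ,
          ENNReal.ofReal_mul (by have := sub_pos.2 h1; positivity), mul_assoc]

lemma measurable_bit (p : ℝ) (k : ℕ) : Measurable fun w : ℕ → ℝ => bit p w k := by
  refine measurable_to_bool ?_
  have hset : (fun w : ℕ → ℝ => bit p w k) ⁻¹' {true} =
      {w | 0 < p} ∩ ⋃ n, {w | discreteArrival p w n = k + 1} := by
    ext w
    simp [bit_eq_true]
  rw [hset]
  refine (MeasurableSet.const _).inter (MeasurableSet.iUnion fun n => ?_)
  have : Measurable fun w : ℕ → ℝ => discreteArrival p w n :=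
    Finset.measurable_sum _ fun m _ => (measurable_gap p).comp (measurable_pi_apply m)
  exact this (measurableSet_singleton _)

lemma map_bit {p : ℝ} (h0 : 0 ≤ p) (h1 : p < 1) :
    (Measure.infinitePi fun _ : ℕ => expMeasure 1).map (fun w k => bit p w k) =
      Measure.infinitePi fun _ => bern p := by
  rcases h0.eq_or_lt with rfl | h0
  · have : (fun (w : ℕ → ℝ) (k : ℕ) => bit 0 w k) = fun _ _ => false := by
      funext w k
      simp [bit]
    rw [this, Measure.map_const, measure_univ, one_smul, bern_zero, Measure.infinitePi_dirac]
  refine eq_infinitePi_of_prefix _ _ fun N a => ?_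
  obtain ⟨n, d, g, hev, -, hprod⟩ := exists_gaps_of_bits h0 h1 a N
  have hmeas : Measurable fun (w : ℕ → ℝ) k => bit p w k :=
    measurable_pi_lambda _ fun k => measurable_bit p k
  have hmset : MeasurableSet {x : ℕ → Bool | ∀ k < N, x k = a k} := by
    have : {x : ℕ → Bool | ∀ k < N, x k = a k} = ⋂ k, ⋂ (_ : k < N), {x | x k = a k} := by
      ext x
      simp
    rw [this]
    exact MeasurableSet.iInter fun k => MeasurableSet.iInter fun _ =>
      measurableSet_eq_fun (measurable_pi_apply k) measurable_const
  rw [Measure.map_apply hmeas hmset, ← hprod]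
  have hset : (fun (w : ℕ → ℝ) k => bit p w k) ⁻¹' {x | ∀ k < N, x k = a k} =
      Set.pi (Finset.range (n + 1)) fun m =>
        if m < n then {W | gap p W = g m} else {W | d < gap p W} := by
    ext w
    simp only [Set.mem_preimage, Set.mem_ofPred_eq, hev w, Set.mem_pi, Finset.coe_range,
      Set.mem_Iio, Nat.forall_lt_succ_right, lt_irrefl, if_false]
    refine and_congr (forall₂_congr fun m hm => ?_) Iff.rfl
    rw [if_pos hm]
    rfl
  rw [hset, Measure.infinitePi_pi, Finset.prod_range_succ, if_neg (lt_irrefl n)]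
  · congr 1
    exact Finset.prod_congr rfl fun m hm => by rw [if_pos (Finset.mem_range.1 hm)]
  · intro m _
    split_ifs
    · exact measurable_gap p (measurableSet_singleton _)
    · exact measurableSet_lt measurable_const (measurable_gap p)

/-! ### The law of the marks of all vertices -/

instance : MeasurableSpace Direction := ⊤

instance : Countable Direction :=
  Function.Injective.countable (f := step) step_injective

/-- The law of independent marks that are `true` with probability `δ₁` for the left clocks and
`δ₂` for the right clocks. -/
noncomputable def bitsMeasure (δ₁ δ₂ : ℝ) : Measure (ℕ × ℕ → Direction → Bool) :=
  Measure.infinitePi fun _ => Measure.infinitePi fun d => bern (rate δ₁ δ₂ d)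

/-- The marks of the unlikely selections; row `k + 1` is listed as row `k`. -/
noncomputable def vertexBits (δ₁ δ₂ : ℝ) (u : ℕ × ℕ → unitInterval × unitInterval) :
    ℕ × ℕ → Direction → Bool
  | q, .left => decide (((u (q.1, q.2 + 1)).1 : ℝ) < δ₁)
  | q, .right => decide (((u (q.1, q.2 + 1)).2 : ℝ) < δ₂)

lemma measurable_of_direction {α : Type*} [MeasurableSpace α] {f : α → Direction → Bool}
    (hl : Measurable fun x => f x .left) (hr : Measurable fun x => f x .right) : Measurable f :=
  measurable_pi_lambda _ fun d => by cases d <;> assumption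

lemma measurable_vertexBits (δ₁ δ₂ : ℝ) : Measurable (vertexBits δ₁ δ₂) :=
  measurable_pi_lambda _ fun q => measurable_of_direction
    ((measurable_decide_lt δ₁).comp (measurable_fst.comp (measurable_pi_apply (q.1, q.2 + 1))))
    ((measurable_decide_lt δ₂).comp (measurable_snd.comp (measurable_pi_apply (q.1, q.2 + 1))))

lemma map_vertexBits (δ₁ δ₂ : ℝ) :
    vertexMeasure.map (vertexBits δ₁ δ₂) = bitsMeasure δ₁ δ₂ := by
  set f : unitInterval × unitInterval → Direction → Bool := fun v d =>
    match d with
    | .left => decide ((v.1 : ℝ) < δ₁)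
    | .right => decide ((v.2 : ℝ) < δ₂) with hf
  have hfm : Measurable f := measurable_of_direction
    ((measurable_decide_lt δ₁).comp measurable_fst) ((measurable_decide_lt δ₂).comp measurable_snd)
  have hfmap : (volume : Measure (unitInterval × unitInterval)).map f =
      Measure.infinitePi fun d => bern (rate δ₁ δ₂ d) := by
    refine Measure.eq_infinitePi _ fun s T hT => ?_
    classical
    have hset : f ⁻¹' (Set.pi s T) =
        {v : unitInterval | .left ∈ s → decide ((v : ℝ) < δ₁) ∈ T .left} ×ˢ
          {v : unitInterval | .right ∈ s → decide ((v : ℝ) < δ₂) ∈ T .right} := by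
      ext v
      simp only [Set.mem_preimage, Set.mem_pi, Set.mem_prod, Set.mem_ofPred_eq, Finset.mem_coe]
      constructor
      · exact fun h => ⟨h .left, h .right⟩
      · rintro ⟨h1, h2⟩ (_ | _)
        · exact h1
        · exact h2
    have hone : ∀ (d : Direction) (p : ℝ),
        (volume : Measure unitInterval) {v : unitInterval | d ∈ s → decide ((v : ℝ) < p) ∈ T d} =
          if d ∈ s then bern p (T d) else 1 := by
      intro d p
      split_ifs with h
      · rw [bern, Measure.map_apply (measurable_decide_lt p) (hT d)]
        simp [h, Set.preimage]
      · simp [h]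
    have hs : s = ({Direction.left, Direction.right} : Finset Direction).filter (· ∈ s) := by
      ext d
      cases d <;> simp
    have hprod := Finset.prod_filter (s := {Direction.left, Direction.right}) (· ∈ s)
      fun d => bern (rate δ₁ δ₂ d) (T d)
    rw [← hs, Finset.prod_pair (by simp)] at hprod
    rw [Measure.map_apply hfm (MeasurableSet.pi s.countable_toSet fun _ _ => hT _), hset,
      Measure.volume_eq_prod, Measure.prod_prod, hone, hone, hprod]
    rfl
  have hinj : Function.Injective fun q : ℕ × ℕ => (q.1, q.2 + 1) := by
    rintro ⟨c, k⟩ ⟨c', k'⟩ h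
    simpa using h
  have h1 := Measure.map_infinitePi_infinitePi_of_inj
    (P := fun _ : ℕ × ℕ => (volume : Measure (unitInterval × unitInterval))) hinj
  have h2 := Measure.infinitePi_map_pi (X := fun _ : ℕ × ℕ => unitInterval × unitInterval)
    (fun _ : ℕ × ℕ => (volume : Measure (unitInterval × unitInterval))) (f := fun _ => f)
    fun _ => hfm
  rw [hfmap, ← h1, Measure.map_map (by fun_prop) (by fun_prop)] at h2
  rw [bitsMeasure, ← h2, vertexMeasure]
  congr 1
  funext u q d
  cases d <;> rfl

lemma measurable_coupledBits (L R ε : ℝ) : Measurable (coupledBits L R ε) :=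
  measurable_pi_lambda _ fun q => measurable_of_direction
    ((measurable_bit (ε * L) q.2).comp (by fun_prop : Measurable fun w : Waiting =>
      w ((q.1 : ℤ) - q.2) .left))
    ((measurable_bit (ε * R) q.2).comp (by fun_prop : Measurable fun w : Waiting =>
      w ((q.1 : ℤ) - q.2 - 1) .right))

/-- The clocks in a listing without repetition are independent. -/
lemma map_clocks {α : Type*} {f : α → ℤ × Direction} (hf : Function.Injective f) :
    waitingMeasure.map (fun w a => w (f a).1 (f a).2) =
      Measure.infinitePi fun _ : α => Measure.infinitePi fun _ : ℕ => expMeasure 1 := by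
  have h1 := Measure.infinitePi_map_curry_symm
    fun (_ : ℤ) (_ : Direction) => Measure.infinitePi fun _ : ℕ => expMeasure 1
  have h2 := Measure.map_infinitePi_infinitePi_of_inj
    (P := fun _ : ℤ × Direction => Measure.infinitePi fun _ : ℕ => expMeasure 1) hf
  rw [← h1, Measure.map_map (by fun_prop) (by fun_prop)] at h2
  exact h2

/-- The clock and the row that decide about a mark. -/
def clockOfMark : (ℕ × ℕ) × Direction → (ℤ × Direction) × ℕ
  | (q, .left) => (((q.1 : ℤ) - q.2, .left), q.2)
  | (q, .right) => (((q.1 : ℤ) - q.2 - 1, .right), q.2)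

lemma clockOfMark_injective : Function.Injective clockOfMark := by
  rintro ⟨⟨c, k⟩, _ | _⟩ ⟨⟨c', k'⟩, _ | _⟩ h <;>
    simp only [clockOfMark, Prod.mk.injEq, reduceCtorEq, and_true, and_false, false_and] at h ⊢ <;>
    omega

/-- The discretized clocks realize the selections of the six-vertex model. -/
lemma map_coupledBits {L R ε : ℝ} (hL : 0 ≤ ε * L) (hR : 0 ≤ ε * R) (hL1 : ε * L < 1)
    (hR1 : ε * R < 1) :
    waitingMeasure.map (coupledBits L R ε) = bitsMeasure (ε * L) (ε * R) := by
  have hbit : ∀ d, (Measure.infinitePi fun _ : ℕ => expMeasure 1).map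
      (fun w k => bit (rate (ε * L) (ε * R) d) w k) =
        Measure.infinitePi fun _ : ℕ => bern (rate (ε * L) (ε * R) d) := by
    rintro (_ | _)
    · exact map_bit hL hL1
    · exact map_bit hR hR1
  have hm : ∀ d, Measurable fun (w : ℕ → ℝ) k => bit (rate (ε * L) (ε * R) d) w k :=
    fun d => measurable_pi_lambda _ fun k => measurable_bit _ k
  have h1 := map_clocks (f := fun κ : ℤ × Direction => κ) Function.injective_id
  have h2 := Measure.infinitePi_map_pi (X := fun _ : ℤ × Direction => ℕ → ℝ)
    (Y := fun _ : ℤ × Direction => ℕ → Bool)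
    (fun _ : ℤ × Direction => Measure.infinitePi fun _ : ℕ => expMeasure 1)
    (f := fun κ w k => bit (rate (ε * L) (ε * R) κ.2) w k) fun κ => hm κ.2
  simp only [hbit] at h2
  have h3 := Measure.infinitePi_map_curry_symm
    fun (κ : ℤ × Direction) (_ : ℕ) => bern (rate (ε * L) (ε * R) κ.2)
  have h4 := Measure.map_infinitePi_infinitePi_of_inj
    (P := fun p : (ℤ × Direction) × ℕ => bern (rate (ε * L) (ε * R) p.1.2)) clockOfMark_injective
  have h5 := Measure.infinitePi_map_curry
    fun (_ : ℕ × ℕ) (d : Direction) => bern (rate (ε * L) (ε * R) d)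
  have h6 : (fun p : (ℕ × ℕ) × Direction => bern (rate (ε * L) (ε * R) (clockOfMark p).1.2)) =
      fun p => bern (rate (ε * L) (ε * R) p.2) := by
    funext ⟨q, d⟩
    cases d <;> rfl
  have hm1 : Measurable fun (w : ℤ × Direction → ℕ → ℝ) κ k =>
      bit (rate (ε * L) (ε * R) κ.2) (w κ) k :=
    measurable_pi_lambda _ fun κ => (hm κ.2).comp (measurable_pi_apply κ)
  rw [h6] at h4
  rw [bitsMeasure, ← h5, ← h4, ← h3, ← h2, ← h1, Measure.map_map hm1 (by fun_prop),
    Measure.map_map (by fun_prop) (hm1.comp (by fun_prop)), Measure.map_map (by fun_prop)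
      ((by fun_prop : Measurable _).comp (hm1.comp (by fun_prop))),
    Measure.map_map (by fun_prop)
      ((by fun_prop : Measurable _).comp
        ((by fun_prop : Measurable _).comp (hm1.comp (by fun_prop))))]
  congr 1
  funext w q d
  cases d <;> rfl

end VertexASEP

/-! ### Almost every sample of the clocks is regular -/

namespace VertexASEP

/-- In a sequence of independent samples, every event of positive probability recurs. -/
lemma ae_frequently_mem {X : Type*} [MeasurableSpace X] (μ : Measure X) [IsProbabilityMeasure μ]
    {S : Set X} (hS : MeasurableSet S) (h0 : μ S ≠ 0) :
    ∀ᵐ x ∂(Measure.infinitePi fun _ : ℕ => μ), ∃ᶠ k in atTop, x k ∈ S := by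
  set s : ℕ → Set (ℕ → X) := fun k => {x | x k ∈ S} with hs
  have hm : ∀ k, MeasurableSet (s k) := fun k => measurable_pi_apply k hS
  have hinter : ∀ I : Finset ℕ, (Measure.infinitePi fun _ : ℕ => μ) (⋂ k ∈ I, s k) =
      ∏ _k ∈ I, μ S := by
    intro I
    rw [← Measure.infinitePi_pi (μ := fun _ : ℕ => μ) (t := fun _ => S) fun _ _ => hS]
    congr 1
    ext x
    simp [hs]
  have hone : ∀ k, (Measure.infinitePi fun _ : ℕ => μ) (s k) = μ S := by
    intro k
    simpa using hinter {k}
  have hind : iIndepSet s (Measure.infinitePi fun _ : ℕ => μ) := by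
    rw [iIndepSet_iff_meas_biInter hm]
    intro I
    rw [hinter]
    exact Finset.prod_congr rfl fun k _ => (hone k).symm
  have h := measure_limsup_eq_one hm hind (by
    simp only [hone]
    exact ENNReal.tsum_const_eq_top_of_ne_zero h0)
  have hml : MeasurableSet (limsup s atTop) := MeasurableSet.measurableSet_limsup hm
  filter_upwards [(prob_compl_eq_zero_iff hml).2 h] with x hx
  exact mem_limsup_iff_frequently_mem.1 hx

/-- The law of the waiting times of one clock. -/
noncomputable abbrev clockMeasure : Measure (ℕ → ℝ) := Measure.infinitePi fun _ => expMeasure 1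

lemma expMeasure_Ioi_ne_zero {c : ℝ} (hc : 0 ≤ c) : expMeasure 1 (Set.Ioi c) ≠ 0 := by
  rw [measure_congr Ioi_ae_eq_Ici, expMeasure_Ici hc]
  simpa using Real.exp_pos _

lemma ae_clock_pos : ∀ᵐ w ∂clockMeasure, ∀ n, 0 < w n := by
  rw [ae_all_iff]
  intro n
  have h : ∀ᵐ W ∂expMeasure 1, 0 < W := by
    refine (prob_compl_eq_zero_iff measurableSet_Ioi).2 ?_
    rw [measure_congr Ioi_ae_eq_Ici, expMeasure_Ici le_rfl]
    simp
  exact (measurePreserving_eval_infinitePi (fun _ : ℕ => expMeasure 1)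
    n).quasiMeasurePreserving.ae h

lemma ae_clock_unbounded : ∀ᵐ w ∂clockMeasure, ∀ c, ∃ n, c < arrival w n := by
  filter_upwards [ae_clock_pos, ae_frequently_mem (expMeasure 1) measurableSet_Ioi
    (expMeasure_Ioi_ne_zero zero_le_one)] with w hpos hfreq
  have key : ∀ K : ℕ, ∃ n, (K : ℝ) < arrival w n := by
    intro K
    induction K with
    | zero => exact ⟨0, by simpa using arrival_pos hpos 0⟩
    | succ K ih =>
      obtain ⟨n, hn⟩ := ih
      obtain ⟨m, hm, hm1⟩ := frequently_atTop.1 hfreq (n + 1)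
      obtain ⟨m, rfl⟩ : ∃ k, m = k + 1 := ⟨m - 1, by omega⟩
      refine ⟨m + 1, ?_⟩
      have h1 := (strictMono_arrival hpos).monotone (show n ≤ m by omega)
      have h2 : arrival w (m + 1) = arrival w m + w (m + 1) := by
        rw [arrival, arrival, Finset.sum_range_succ _ (m + 1)]
      have h3 : 1 < w (m + 1) := hm1
      push_cast
      linarith
  intro c
  obtain ⟨K, hK⟩ := exists_nat_gt c
  obtain ⟨n, hn⟩ := key K
  exact ⟨n, hK.trans hn⟩

lemma measurable_arrival (n : ℕ) : Measurable fun w : ℕ → ℝ => arrival w n :=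
  Finset.measurable_sum _ fun m _ => measurable_pi_apply m

lemma ae_arrival_ne (n : ℕ) (c : ℝ) : ∀ᵐ w ∂clockMeasure, arrival w n ≠ c := by
  have hind := iIndepFun_infinitePi (P := fun _ : ℕ => expMeasure 1) (X := fun _ W => W)
    fun _ => measurable_id
  have hind2 := hind.indepFun_finsetSum_of_notMem (fun k => measurable_pi_apply k)
    (s := Finset.range n) (i := n) (by simp)
  have hsum : Measurable (∑ j ∈ Finset.range n, fun w : ℕ → ℝ => w j) := by
    have := Finset.measurable_sum (Finset.range n) fun m _ =>
      (measurable_pi_apply m : Measurable fun w : ℕ → ℝ => w m)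
    convert this using 1
    ext w
    simp
  have hmap := hind2.map_prod_eq_prod_map_map hsum.aemeasurable (measurable_pi_apply n).aemeasurable
  rw [Measure.infinitePi_map_eval (fun _ : ℕ => expMeasure 1) n] at hmap
  have hS : MeasurableSet {p : ℝ × ℝ | p.1 + p.2 = c} :=
    measurableSet_eq_fun (measurable_fst.add measurable_snd) measurable_const
  have hnull : ((clockMeasure.map (∑ j ∈ Finset.range n, fun w : ℕ → ℝ => w j)).prod
      (expMeasure 1)) {p : ℝ × ℝ | p.1 + p.2 = c} = 0 := by
    rw [Measure.measure_prod_null hS]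
    refine Eventually.of_forall fun s => ?_
    have : Prod.mk s ⁻¹' {p : ℝ × ℝ | p.1 + p.2 = c} = {c - s} := by
      ext W
      simp only [Set.mem_preimage, Set.mem_ofPred_eq, Set.mem_singleton_iff]
      constructor <;> intro h <;> linarith
    simp only [this, measure_singleton]
    rfl
  rw [← hmap, Measure.map_apply (hsum.prodMk (measurable_pi_apply n)) hS] at hnull
  rw [ae_iff]
  convert hnull using 2
  ext w
  simp [arrival, Finset.sum_range_succ, Finset.sum_apply]

lemma measurePreserving_clock (i : ℤ) (d : Direction) :
    MeasurePreserving (fun w : Waiting => w i d) waitingMeasure clockMeasure :=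
  (measurePreserving_eval_infinitePi (fun _ : Direction => clockMeasure) d).comp
    (measurePreserving_eval_infinitePi
      (fun _ : ℤ => Measure.infinitePi fun _ : Direction => clockMeasure) i)

lemma ae_clocks {p : ℤ → Direction → (ℕ → ℝ) → Prop}
    (h : ∀ i d, ∀ᵐ v ∂clockMeasure, p i d v) : ∀ᵐ w ∂waitingMeasure, ∀ i d, p i d (w i d) := by
  simp only [ae_all_iff]
  exact fun i d => (measurePreserving_clock i d).quasiMeasurePreserving.ae (h i d)

lemma ae_arrival_ne_arrival {i i' : ℤ} {d d' : Direction} (hne : (i, d) ≠ (i', d')) {c c' : ℝ}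
    (hc : 0 < c) (n n' : ℕ) :
    ∀ᵐ w ∂waitingMeasure, c' * arrival (w i d) n ≠ c * arrival (w i' d') n' := by
  have h1 := map_clocks (f := fun κ : ℤ × Direction => κ) Function.injective_id
  have h2 := Measure.infinitePi_map_eval_prod (P := fun _ : ℤ × Direction => clockMeasure) hne
  rw [← h1, Measure.map_map (by fun_prop) (by fun_prop)] at h2
  have hS : MeasurableSet {p : (ℕ → ℝ) × (ℕ → ℝ) | c' * arrival p.1 n = c * arrival p.2 n'} :=
    measurableSet_eq_fun (((measurable_arrival n).comp measurable_fst).const_mul _)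
      (((measurable_arrival n').comp measurable_snd).const_mul _)
  have hnull : (clockMeasure.prod clockMeasure)
      {p : (ℕ → ℝ) × (ℕ → ℝ) | c' * arrival p.1 n = c * arrival p.2 n'} = 0 := by
    rw [Measure.measure_prod_null hS]
    refine Eventually.of_forall fun v => ?_
    refine measure_mono_null (fun v' hv' => ?_)
      (ae_iff.1 (ae_arrival_ne n' (c' * arrival v n / c)))
    simp only [Set.mem_preimage, Set.mem_ofPred_eq] at hv'
    simp only [Set.mem_ofPred_eq, not_not]
    rw [hv', mul_div_cancel_left₀ _ hc.ne']
  rw [← h2, Measure.map_apply (by fun_prop) hS] at hnull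
  rw [ae_iff]
  simpa using hnull

/-- Among the edges `(g k, g k + 1)` there are infinitely many inactive ones. -/
lemma ae_frequently_inactive {L R t : ℝ} (hL : 0 ≤ L) (hR : 0 ≤ R) (ht : 0 ≤ t) {g : ℕ → ℤ}
    (hg : Function.Injective g) :
    ∀ᵐ w ∂waitingMeasure, ∃ᶠ k in atTop,
      R * t < w (g k) .right 0 ∧ L * t < w (g k + 1) .left 0 := by
  classical
  set f : ℕ × Direction → ℤ × Direction := fun q =>
    match q with
    | (k, .left) => (g k + 1, .left)
    | (k, .right) => (g k, .right) with hf
  have hfinj : Function.Injective f := by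
    rintro ⟨k, _ | _⟩ ⟨k', _ | _⟩ h <;> simp [hf, hg.eq_iff] at h <;> simp [h]
  have h1 := map_clocks hfinj
  have h2 := Measure.infinitePi_map_curry fun (_ : ℕ) (_ : Direction) => clockMeasure
  rw [← h1, Measure.map_map (by fun_prop) (by fun_prop)] at h2
  set S : Set (Direction → ℕ → ℝ) :=
    Set.pi ({Direction.left, Direction.right} : Finset Direction)
      fun d => {v | rate L R d * t < v 0} with hS
  have hSd : ∀ d, MeasurableSet {v : ℕ → ℝ | rate L R d * t < v 0} := fun d =>
    measurableSet_lt measurable_const (measurable_pi_apply 0)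
  have hSm : MeasurableSet S := MeasurableSet.pi (Finset.countable_toSet _) fun d _ => hSd d
  have hS0 : (Measure.infinitePi fun _ : Direction => clockMeasure) S ≠ 0 := by
    rw [hS, Measure.infinitePi_pi _ fun d _ => hSd d]
    refine Finset.prod_ne_zero_iff.2 fun d _ => ?_
    have hd : 0 ≤ rate L R d * t := mul_nonneg (by cases d <;> assumption) ht
    have := (measurePreserving_eval_infinitePi (fun _ : ℕ => expMeasure 1) 0).measure_preimage
      (measurableSet_Ioi (a := rate L R d * t)).nullMeasurableSet
    have h3 := expMeasure_Ioi_ne_zero hd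
    rw [← this] at h3
    exact h3
  have h3 := ae_frequently_mem (Measure.infinitePi fun _ : Direction => clockMeasure) hSm hS0
  rw [← h2] at h3
  filter_upwards [ae_of_ae_map
    ((MeasurableEquiv.measurable _).comp (by fun_prop)).aemeasurable h3] with w hw
  refine hw.mono fun k hk => ?_
  rw [hS, Set.mem_pi] at hk
  exact ⟨hk .right (by simp), hk .left (by simp)⟩

theorem ae_regular {L R t : ℝ} (hL : 0 ≤ L) (hR : 0 ≤ R) (ht : 0 < t) :
    ∀ᵐ w ∂waitingMeasure, Regular L R t w := by
  have hne : ∀ᵐ w ∂waitingMeasure, ∀ i d i' d', (i, d) ≠ (i', d') → 0 < rate L R d →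
      0 < rate L R d' → ∀ n n',
        rate L R d' * arrival (w i d) n ≠ rate L R d * arrival (w i' d') n' := by
    simp only [ae_all_iff]
    exact fun i d i' d' h hd hd' n n' => ae_arrival_ne_arrival h hd n n'
  filter_upwards [ae_clocks fun _ _ => ae_clock_pos, ae_clocks fun _ _ => ae_clock_unbounded,
    ae_clocks fun i d => ae_all_iff.2 fun n => ae_arrival_ne n (rate L R d * t), hne,
    ae_frequently_inactive hL hR ht.le (g := fun k => (k : ℤ)) Nat.cast_injective,
    ae_frequently_inactive hL hR ht.le (g := fun k => -(k : ℤ))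
      (neg_injective.comp Nat.cast_injective)] with w h1 h2 h3 h4 h5 h6
  refine ⟨h1, h2, h3, h4, fun m => ?_, fun m => ?_⟩
  · obtain ⟨k, hk, h⟩ := frequently_atTop.1 h6 m.natAbs
    exact ⟨-k, by omega, h⟩
  · obtain ⟨k, hk, h⟩ := frequently_atTop.1 h5 m.natAbs
    exact ⟨k, by omega, h⟩

end VertexASEP

/-! ### Convergence -/

namespace VertexASEP

lemma completion_congr {δ₁ δ₂ δ₁' δ₂' : ℝ} {v v' : unitInterval × unitInterval}
    (h₁ : (v.1 : ℝ) < δ₁ ↔ (v'.1 : ℝ) < δ₁') (h₂ : (v.2 : ℝ) < δ₂ ↔ (v'.2 : ℝ) < δ₂') (e f : Edge) :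
    completion δ₁ δ₂ v e f = completion δ₁' δ₂' v' e f := by
  rcases e with _ | c <;> rcases f with _ | d <;> simp [completion, h₁, h₂]

/-- The path ensemble only depends on the sets of unlikely selections. -/
lemma vertical_congr {δ₁ δ₂ δ₁' δ₂' : ℝ} {u u' : ℕ × ℕ → unitInterval × unitInterval}
    (h₁ : ∀ p y, ((u (p, y + 1)).1 : ℝ) < δ₁ ↔ ((u' (p, y + 1)).1 : ℝ) < δ₁')
    (h₂ : ∀ p y, ((u (p, y + 1)).2 : ℝ) < δ₂ ↔ ((u' (p, y + 1)).2 : ℝ) < δ₂')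
    (φ : ℕ → Bool × Bool) (y : ℕ) : vertical δ₁ δ₂ φ u y = vertical δ₁' δ₂' φ u' y := by
  induction y with
  | zero =>
    funext p
    cases p <;> rfl
  | succ y ih =>
    have hrow : ∀ (left : Edge) (p : ℕ),
        rowRight δ₁ δ₂ (vertical δ₁ δ₂ φ u y) left (fun q => u (q, y + 1)) p =
          rowRight δ₁' δ₂' (vertical δ₁' δ₂' φ u' y) left (fun q => u' (q, y + 1)) p := by
      intro left p
      induction p with
      | zero => rfl
      | succ p ihp =>
        rw [rowRight, rowRight, ihp, ih, completion_congr (h₁ (p + 1) y) (h₂ (p + 1) y)]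
    funext p
    cases p with
    | zero => rfl
    | succ p => rw [vertical, vertical, hrow, ih, completion_congr (h₁ (p + 1) y) (h₂ (p + 1) y)]

lemma height_eq_bitHeight (δ₁ δ₂ : ℝ) (φ : ℕ → Bool × Bool)
    (u : ℕ × ℕ → unitInterval × unitInterval) (X : ℤ) (Y : ℕ) :
    height δ₁ δ₂ φ u X Y = bitHeight φ (vertexBits δ₁ δ₂ u) X Y := by
  unfold bitHeight height
  rw [vertical_congr (δ₁' := 1 / 2) (δ₂' := 1 / 2)
    (u' := fun q => toSelection (vertexBits δ₁ δ₂ u (q.1, q.2 - 1)))]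
  · intro p y
    rw [toSelection_fst_lt]
    simp [vertexBits]
  · intro p y
    rw [toSelection_snd_lt]
    simp [vertexBits]

instance : Finite Direction :=
  Finite.of_surjective (fun b : Bool => if b then Direction.left else Direction.right) fun d => by
    cases d
    · exact ⟨true, rfl⟩
    · exact ⟨false, rfl⟩

instance : Finite PathColor :=
  Finite.of_surjective (fun b : Bool => if b then PathColor.red else PathColor.blue) fun d => by
    cases d
    · exact ⟨true, rfl⟩
    · exact ⟨false, rfl⟩

instance : MeasurableSpace Edge := ⊤

instance : DiscreteMeasurableSpace Edge := ⟨fun _ => trivial⟩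

lemma measurable_completion_toSelection (δ₁ δ₂ : ℝ) :
    Measurable fun z : (Direction → Bool) × Edge × Edge =>
      completion δ₁ δ₂ (toSelection z.1) z.2.1 z.2.2 :=
  Measurable.of_discrete

lemma measurable_vertical (y p : ℕ) :
    Measurable fun z : (ℕ → Bool × Bool) × (ℕ × ℕ → Direction → Bool) =>
      vertical (1 / 2) (1 / 2) z.1 (fun q => toSelection (z.2 (q.1, q.2 - 1))) y p := by
  have hsel : ∀ q, Measurable fun z : (ℕ → Bool × Bool) × (ℕ × ℕ → Direction → Bool) => z.2 q :=
    fun q => (measurable_pi_apply q).comp measurable_snd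
  have hφ : ∀ i, Measurable fun z : (ℕ → Bool × Bool) × (ℕ × ℕ → Direction → Bool) => z.1 i :=
    fun i => (measurable_pi_apply i).comp measurable_fst
  induction y generalizing p with
  | zero =>
    cases p with
    | zero => exact measurable_const
    | succ p =>
      exact (Measurable.of_discrete (f := fun b : Bool × Bool =>
        (if b.1 then some PathColor.red else none : Edge))).comp (hφ (p + 1))
  | succ y ih =>
    have hrow : ∀ p, Measurable fun z : (ℕ → Bool × Bool) × (ℕ × ℕ → Direction → Bool) =>
        rowRight (1 / 2) (1 / 2)
          (vertical (1 / 2) (1 / 2) z.1 (fun q => toSelection (z.2 (q.1, q.2 - 1))) y)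
          (if (z.1 (y + 1)).2 then some PathColor.blue else none)
          (fun q => toSelection (z.2 (q, y))) p := by
      intro p
      induction p with
      | zero =>
        exact (Measurable.of_discrete (f := fun b : Bool × Bool =>
          (if b.2 then some PathColor.blue else none : Edge))).comp (hφ (y + 1))
      | succ p ihp =>
        exact measurable_snd.comp ((measurable_completion_toSelection (1 / 2) (1 / 2)).comp
          ((hsel (p + 1, y)).prodMk ((ih (p + 1)).prodMk ihp)))
    cases p with
    | zero => exact measurable_const
    | succ p =>
      exact measurable_fst.comp ((measurable_completion_toSelection (1 / 2) (1 / 2)).comp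
        ((hsel (p + 1, y)).prodMk ((ih (p + 1)).prodMk (hrow p))))

lemma measurable_bitHeight (X : ℤ) (Y : ℕ) :
    Measurable fun z : (ℕ → Bool × Bool) × (ℕ × ℕ → Direction → Bool) =>
      bitHeight z.1 z.2 X Y := by
  have hset : ∀ (q : ℕ → Prop) (c : PathColor),
      Measurable fun z : (ℕ → Bool × Bool) × (ℕ × ℕ → Direction → Bool) =>
        (({p : ℕ | q p ∧ vertical (1 / 2) (1 / 2) z.1
          (fun q => toSelection (z.2 (q.1, q.2 - 1))) Y p = some c}.ncard : ℕ) : ℤ) := by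
    intro q c
    refine (Measurable.of_discrete (f := fun n : ℕ => (n : ℤ))).comp (measurable_ncard.comp ?_)
    refine measurable_set_iff.2 fun p => measurableSet_setOfPred.1 ?_
    exact (MeasurableSet.const _).inter
      (measurable_vertical Y p (MeasurableSet.of_discrete (s := {some c})))
  exact (hset _ _).sub (hset _ _)

lemma measurableSet_le_bitHeight {α : Type*} [MeasurableSpace α] {ψ : α → ℕ → Bool × Bool}
    (hψ : Measurable ψ) {b : α → ℕ × ℕ → Direction → Bool} (hb : Measurable b) (X : ℤ) (Y : ℕ)
    (r : ℝ) : MeasurableSet {z | r ≤ (bitHeight (ψ z) (b z) X Y : ℝ)} := by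
  have h0 : Measurable fun z => (ψ z, b z) := hψ.prodMk hb
  have h1 := (measurable_bitHeight X Y).comp h0
  have h2 : Measurable fun n : ℤ => (n : ℝ) := Measurable.of_discrete
  exact measurableSet_le measurable_const (h2.comp h1)

/-- The height probability, computed with the coupled discretized clocks. -/
lemma heightProb_eq {Ω : Type*} [MeasurableSpace Ω] (P : Measure Ω) [IsProbabilityMeasure P]
    {φ : ℕ → Ω → Bool × Bool} (hφ : ∀ i, Measurable (φ i)) {L R ε : ℝ} (hL : 0 ≤ ε * L)
    (hR : 0 ≤ ε * R) (hL1 : ε * L < 1) (hR1 : ε * R < 1) (X : ℤ) (Y : ℕ) (r : ℝ) :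
    heightProb P φ (ε * L) (ε * R) X Y r = (P.prod waitingMeasure).real
      {ω | r ≤ (bitHeight (fun i => φ i ω.1) (coupledBits L R ε ω.2) X Y : ℝ)} := by
  set S : Set (Ω × (ℕ × ℕ → Direction → Bool)) :=
    {z | r ≤ (bitHeight (fun i => φ i z.1) z.2 X Y : ℝ)} with hS
  have hSm : MeasurableSet S := measurableSet_le_bitHeight
    (measurable_pi_lambda _ fun i => (hφ i).comp measurable_fst) measurable_snd X Y r
  have h1 : P.prod (bitsMeasure (ε * L) (ε * R)) =
      (P.prod vertexMeasure).map (Prod.map id (vertexBits (ε * L) (ε * R))) := by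
    rw [← Measure.map_prod_map _ _ measurable_id (measurable_vertexBits _ _), Measure.map_id,
      map_vertexBits]
  have h2 : P.prod (bitsMeasure (ε * L) (ε * R)) =
      (P.prod waitingMeasure).map (Prod.map id (coupledBits L R ε)) := by
    rw [← Measure.map_prod_map _ _ measurable_id (measurable_coupledBits _ _ _), Measure.map_id,
      map_coupledBits hL hR hL1 hR1]
  have h3 : (P.prod vertexMeasure) (Prod.map id (vertexBits (ε * L) (ε * R)) ⁻¹' S) =
      (P.prod waitingMeasure) (Prod.map id (coupledBits L R ε) ⁻¹' S) := by
    rw [← Measure.map_apply (measurable_id.prodMap (measurable_vertexBits _ _)) hSm,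
      ← Measure.map_apply (measurable_id.prodMap (measurable_coupledBits _ _ _)) hSm, ← h1, ← h2]
  unfold heightProb Measure.real
  congr 1
  rw [show (Prod.map id (coupledBits L R ε) ⁻¹' S) = {ω | r ≤ (bitHeight (fun i => φ i ω.1)
    (coupledBits L R ε ω.2) X Y : ℝ)} from rfl] at h3
  rw [← h3]
  congr 1
  ext ω
  simp [hS, height_eq_bitHeight]

end VertexASEP

theorem corollary4 {Ω : Type*} [MeasurableSpace Ω] (P : Measure Ω) [IsProbabilityMeasure P]
    (φ : ℕ → Ω → Bool × Bool) (hφ : ∀ i, Measurable (φ i))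
    (L R : ℝ) (hL : 0 ≤ L) (hR : 0 ≤ R) (r t : ℝ) (ht : 0 < t) (x : ℤ) :
    Tendsto
      (fun ε : ℝ => VertexASEP.heightProb P φ (ε * L) (ε * R)
        (x + (⌊ε⁻¹ * t⌋₊ : ℤ)) ⌊ε⁻¹ * t⌋₊ r)
      (𝓝[>] 0)
      (𝓝 (VertexASEP.currentProb P φ L R t x r)) := by
  open VertexASEP in
  set μ := P.prod waitingMeasure with hμ
  set S : ℝ → Set (Ω × Waiting) := fun ε => {ω | r ≤ (bitHeight (fun i => φ i ω.1)
    (coupledBits L R ε ω.2) (x + (⌊ε⁻¹ * t⌋₊ : ℤ)) ⌊ε⁻¹ * t⌋₊ : ℝ)} with hS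
  set A : Set (Ω × Waiting) := {ω | r ≤ (current L R (fun i => φ i ω.1) ω.2 t x : ℝ)} with hA
  have hSm : ∀ ε, MeasurableSet (S ε) := fun ε => measurableSet_le_bitHeight
    (measurable_pi_lambda _ fun i => (hφ i).comp measurable_fst)
    ((measurable_coupledBits L R ε).comp measurable_snd) _ _ r
  have hlim : ∀ᵐ ω ∂μ, ∀ᶠ ε in 𝓝[>] (0 : ℝ), ω ∈ S ε ↔ ω ∈ A := by
    have h : ∀ᵐ ω ∂μ, Regular L R t ω.2 :=
      Measure.quasiMeasurePreserving_snd.ae (ae_regular hL hR ht)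
    filter_upwards [h] with ω hω
    filter_upwards [hω.eventually_bitHeight_eq hL hR ht x] with ε hε
    simp only [hS, hA, Set.mem_ofPred_eq, hε]
  -- The current is measurable only up to null sets, as a limit of the height functions.
  have hAm : NullMeasurableSet A μ :=
    nullMeasurableSet_of_tendsto_indicator (𝓝[>] (0 : ℝ)) (fun ε => (hSm ε).nullMeasurableSet) hlim
  have hlim' : ∀ᵐ ω ∂μ, ∀ᶠ ε in 𝓝[>] (0 : ℝ), ω ∈ S ε ↔ ω ∈ toMeasurable μ A := by
    filter_upwards [hlim, hAm.toMeasurable_ae_eq.mem_iff] with ω h1 h2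
    simpa only [h2] using h1
  have hmain := tendsto_measure_of_ae_tendsto_indicator_of_isFiniteMeasure (𝓝[>] (0 : ℝ))
    (measurableSet_toMeasurable μ A) hSm hlim'
  rw [measure_toMeasurable] at hmain
  have hreal : Tendsto (fun ε => μ.real (S ε)) (𝓝[>] 0) (𝓝 (μ.real A)) :=
    (ENNReal.tendsto_toReal (measure_ne_top μ A)).comp hmain
  have hsmall : ∀ c : ℝ, ∀ᶠ ε in 𝓝[>] (0 : ℝ), ε * c < 1 := by
    intro c
    have h1 : Tendsto (fun ε : ℝ => ε * c) (𝓝 0) (𝓝 0) := by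
      simpa using (tendsto_id (α := ℝ) (x := 𝓝 0)).mul_const c
    exact (h1.mono_left nhdsWithin_le_nhds).eventually (gt_mem_nhds one_pos)
  refine hreal.congr' ?_
  filter_upwards [hsmall L, hsmall R, eventually_mem_nhdsWithin] with ε h1 h2 (h3 : 0 < ε)
  exact (heightProb_eq P hφ (mul_nonneg h3.le hL) (mul_nonneg h3.le hR) h1 h2 _ _ _).symm
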